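/- Let $m\ge 0$ be an integer, let $\mathfrak{h}\subset\mathfrak{sl}_m(\mathbb{C})$ be the Cartan subalgebra of traceless diagonal matrices, let $e_i\in\mathfrak{h}^*$ be the functional taking the $i$-th diagonal entry, and let $\Lambda\subset\mathfrak{h}^*$ be the integral weight lattice, that is, the group of functionals taking integer values on all coroots $E_{ii}-E_{jj}$. For $\lambda\in\Lambda$ let $\mathrm{M}(\lambda)$ be the Verma module of highest weight $\lambda$, that is, the quotient of $U(\mathfrak{sl}_m(\mathbb{C}))$ by the left ideal generated by the strictly upper triangular matrices and the elements $h-\lambda(h)\cdot 1$ for $h\in\mathfrak{h}$. For $\mu\in\Lambda$ let $\mathrm{M}(\lambda)_\mu=\{v\in \mathrm{M}(\lambda): hv=\mu(h)v \text{ for all } h\in\mathfrak{h}\}$ be the weight space of weight $\mu$, and for $i,j\in[m]$ write $\mu(i,j)=\mu+e_i-e_j$. Then, for all $\lambda,\mu\in\Lambda$, the weight space $\mathrm{M}(\lambda)_\mu$ is finite-dimensional, its dimension is the Kostant partition function value $p(\mu-\lambda)$, the number of ways to write $\mu-\lambda$ as a sum of negative roots $e_i-e_j$ ($i>j$) with multiplicities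 in $\mathbb{N}$, the order of the summands being irrelevant, and \[ (\dim \mathrm{M}(\lambda)_\mu)^2 \ \ge\ \dim \mathrm{M}(\lambda)_{\mu(i,j)}\cdot \dim \mathrm{M}(\lambda)_{\mu(j,i)}\qquad\text{for all } i,j\in[m]. \] -/

import Mathlib

noncomputable section

namespace VermaSl

open LieAlgebra.SpecialLinear

attribute [local instance 100] LieRing.ofAssociativeRing

/-- The Lie algebra `𝔰𝔩ₘ(ℂ)` of traceless complex matrices. -/
abbrev SL (m : ℕ) : LieSubalgebra ℂ (Matrix (Fin m) (Fin m) ℂ) := sl (Fin m) ℂ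

/-- The standard Cartan subalgebra `𝔥` of `𝔰𝔩ₘ(ℂ)`: the traceless diagonal matrices. -/
def cartan (m : ℕ) : LieSubalgebra ℂ (SL m) where
  carrier := {x | x.val.IsDiag}
  add_mem' hx hy := hx.add hy
  zero_mem' := Matrix.isDiag_zero
  smul_mem' c _ hx := hx.smul c
  lie_mem' := by
    intro x y hx hy
    change (x.val * y.val - y.val * x.val).IsDiag
    rw [← (Matrix.isDiag_iff_diagonal_diag _).1 hx, ← (Matrix.isDiag_iff_diagonal_diag _).1 hy,
      Matrix.diagonal_mul_diagonal, Matrix.diagonal_mul_diagonal]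
    exact (Matrix.isDiag_diagonal _).sub (Matrix.isDiag_diagonal _)

/-- The coroot `Eᵢᵢ - Eⱼⱼ`, as an element of the Cartan subalgebra. -/
def coroot {m : ℕ} (i j : Fin m) : cartan m :=
  ⟨singleSubSingle i j 1, by
    change (Matrix.single i i (1 : ℂ) - Matrix.single j j 1).IsDiag
    rw [← Matrix.diagonal_single, ← Matrix.diagonal_single]
    exact (Matrix.isDiag_diagonal _).sub (Matrix.isDiag_diagonal _)⟩

/-- The integral weight lattice `Λ ⊆ 𝔥*`: the functionals with integer values on all coroots. -/
def weightLattice (m : ℕ) : AddSubgroup (Module.Dual ℂ (cartan m)) where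
  carrier := {f | ∀ i j : Fin m, ∃ n : ℤ, f (coroot i j) = n}
  add_mem' := by
    intro f g hf hg i j
    obtain ⟨a, ha⟩ := hf i j
    obtain ⟨b, hb⟩ := hg i j
    exact ⟨a + b, by simp [ha, hb]⟩
  zero_mem' := fun _ _ => ⟨0, by simp⟩
  neg_mem' := by
    intro f hf i j
    obtain ⟨a, ha⟩ := hf i j
    exact ⟨-a, by simp [ha]⟩

/-- The integral weight `eᵢ`: the functional sending a traceless diagonal matrix to its `i`-th
diagonal entry. -/
def e {m : ℕ} (i : Fin m) : weightLattice m :=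
  ⟨{ toFun := fun h => h.val.val i i
     map_add' := fun _ _ => rfl
     map_smul' := fun _ _ => rfl }, by
    intro k l
    change ∃ n : ℤ, (Matrix.single k k 1 - Matrix.single l l 1 : Matrix (Fin m) (Fin m) ℂ) i i = n
    refine ⟨(Matrix.single k k 1 - Matrix.single l l 1 : Matrix (Fin m) (Fin m) ℤ) i i, ?_⟩
    simp only [Matrix.sub_apply, Matrix.single_apply]
    push_cast
    rfl⟩

/-- The weight `μ(i,j) = μ + eᵢ - eⱼ`. -/
def shift {m : ℕ} (μ : weightLattice m) (i j : Fin m) : weightLattice m := μ + e i - e j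

/-- The left ideal of `U(𝔰𝔩ₘ)` generated by the strictly upper triangular matrices and by the
elements `h - λ(h)·1` for `h` in the Cartan subalgebra. -/
def vermaIdeal {m : ℕ} (l : weightLattice m) :
    Submodule (UniversalEnvelopingAlgebra ℂ (SL m)) (UniversalEnvelopingAlgebra ℂ (SL m)) :=
  Submodule.span _
    ({u | ∃ x : SL m, (∀ i j : Fin m, j ≤ i → x.val i j = 0) ∧
        u = UniversalEnvelopingAlgebra.ι ℂ x} ∪
     {u | ∃ h : cartan m, u = UniversalEnvelopingAlgebra.ι ℂ (h : SL m) -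
        algebraMap ℂ (UniversalEnvelopingAlgebra ℂ (SL m)) (l.val h)})

/-- The Verma module `M(λ)`, the universal highest weight module of highest weight `λ`. -/
abbrev Verma {m : ℕ} (l : weightLattice m) : Type :=
  UniversalEnvelopingAlgebra ℂ (SL m) ⧸ vermaIdeal l

/-- `𝔰𝔩ₘ(ℂ)` acts on `M(λ)` through its universal enveloping algebra. -/
instance {m : ℕ} (l : weightLattice m) : LieRingModule (SL m) (Verma l) where
  bracket x v := UniversalEnvelopingAlgebra.ι ℂ x • v
  add_lie x y v := by
    change UniversalEnvelopingAlgebra.ι ℂ (x + y) • v = _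
    rw [map_add, add_smul]
  lie_add x v w := smul_add _ v w
  leibniz_lie x y v := by
    change UniversalEnvelopingAlgebra.ι ℂ x • UniversalEnvelopingAlgebra.ι ℂ y • v =
      UniversalEnvelopingAlgebra.ι ℂ ⁅x, y⁆ • v +
      UniversalEnvelopingAlgebra.ι ℂ y • UniversalEnvelopingAlgebra.ι ℂ x • v
    rw [LieHom.map_lie, LieRing.of_associative_ring_bracket, sub_smul, mul_smul, mul_smul,
      sub_add_cancel]

instance {m : ℕ} (l : weightLattice m) : LieModule ℂ (SL m) (Verma l) where
  smul_lie c x v := by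
    change UniversalEnvelopingAlgebra.ι ℂ (c • x) • v = c • UniversalEnvelopingAlgebra.ι ℂ x • v
    rw [map_smul, smul_assoc]
  lie_smul c x v := smul_comm (UniversalEnvelopingAlgebra.ι ℂ x) c v

/-- The weight space `M(λ)_μ = {v : h v = μ(h) v for all h ∈ 𝔥}`. -/
def vermaWeightSpace {m : ℕ} (l μ : weightLattice m) : Submodule ℂ (Verma l) :=
  (LieModule.weightSpace (L := cartan m) (Verma l) μ.val).toSubmodule

/-- The Kostant partition function: the number of ways to write `ν` as a sum of negative roots
`eᵢ - eⱼ`, `i > j`, the coefficient of each root being a natural number. -/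
def kostantPartition {m : ℕ} (ν : weightLattice m) : ℕ :=
  Nat.card {c : {p : Fin m × Fin m // p.2 < p.1} → ℕ //
    ∑ p, c p • (e p.val.1 - e p.val.2) = ν}

end VermaSl

end

/-! Ordered monomials in the negative root vectors form a basis of `M(λ)`, and each is a weight
vector, of weight `λ` plus the sum of its roots. Hence `M(λ)_μ` has a basis indexed by the
multiplicity vectors that `p(μ-λ)` counts (`finrank_vermaWeightSpace`), and a height bound makes
these finite in number (`finite_rootSum_eq`). The basis comes from Poincaré–Birkhoff–Witt for Lie
algebras of matrices: sorting words gives spanning (`span_ordered_monomials`), and letting `U(L)`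
act on polynomials by translation-invariant derivations and reading off leading terms at the
identity gives independence (`linearIndependent_ordered_monomials`).

What remains is log-concavity of `p` in root directions. Call a positive function `c` on `ℤ^ι`
Lorentzian if every matrix `c (α + eᵢ + eⱼ)` has exactly one positive eigenvalue. The Gaussian
`q^{|β|²}`, `0 < q < 1`, is Lorentzian (`isLorentzian_gauss`), and so is any sum of the first `K +
1` translates of a Lorentzian function along a root (`IsLorentzian.sum_translates`). Summing along
every negative root and letting `q → 0` replaces the Gaussian by the indicator of `0`, so the sum
becomes the number of representations with coefficients at most `K`. The `2 × 2` minors give the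
inequality (`card_combinations_log_concave`), and for `K` large this number is `p`. -/

noncomputable section

/-! ### Poincaré–Birkhoff–Witt: ordered monomials span -/

namespace UEAWords

attribute [local instance 100] LieRing.ofAssociativeRing

open UniversalEnvelopingAlgebra

section Words

variable {κ : Type*}

/-- The nondecreasing word, with respect to the order of the list `ℓ`, in which each letter `i`
occurs `d i` times. -/
def word (ℓ : List κ) (d : κ →₀ ℕ) : List κ := ℓ.flatMap fun i => List.replicate (d i) i

lemma count_word [DecidableEq κ] {ℓ : List κ} (hnd : ℓ.Nodup) (d : κ →₀ ℕ) (a : κ) :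
    (word ℓ d).count a = if a ∈ ℓ then d a else 0 := by
  induction ℓ with
  | nil => simp [word]
  | cons b ℓ ih =>
    have hb := List.nodup_cons.1 hnd
    have hw : word (b :: ℓ) d = List.replicate (d b) b ++ word ℓ d := by simp [word]
    rw [hw, List.count_append, ih hb.2, List.count_replicate]
    by_cases h : b = a
    · subst h; simp [hb.1]
    · simp [h, Ne.symm h]

lemma prod_map_word {M : Type*} [CommMonoid M] [Fintype κ] {ℓ : List κ} (hnd : ℓ.Nodup)
    (hmem : ∀ i, i ∈ ℓ) (d : κ →₀ ℕ) (t : κ → M) :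
    ((word ℓ d).map t).prod = ∏ i, t i ^ d i := by
  classical
  have h : ∀ ℓ : List κ, ((word ℓ d).map t).prod = (ℓ.map fun i => t i ^ d i).prod := by
    intro ℓ
    induction ℓ with
    | nil => simp [word]
    | cons b ℓ ih =>
      have hw : word (b :: ℓ) d = List.replicate (d b) b ++ word ℓ d := by simp [word]
      simp [hw, ih]
  rw [h, ← List.prod_toFinset _ hnd]
  congr 1
  ext i
  simp [hmem]

lemma length_word [Fintype κ] {ℓ : List κ} (hnd : ℓ.Nodup) (hmem : ∀ i, i ∈ ℓ) (d : κ →₀ ℕ) :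
    (word ℓ d).length = d.degree := by
  -- Giving every letter weight `1` in `Multiplicative ℕ` turns the product into the length.
  have h := prod_map_word hnd hmem d (fun _ => Multiplicative.ofAdd 1)
  have h2 := congrArg Multiplicative.toAdd h
  simpa [Finsupp.degree_eq_sum, toAdd_prod, toAdd_pow] using h2

end Words

variable (R : Type*) [CommRing R] {L : Type*} [LieRing L] [LieAlgebra R L] {κ : Type*}

/-- Since `ι` lands in the subalgebra, it lifts to a map from `U(L)` to it; by uniqueness of lifts,
following this by the inclusion gives the identity. -/
lemma adjoin_range_ι : Algebra.adjoin R (Set.range (ι R : L → UniversalEnvelopingAlgebra R L)) = ⊤ := by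
  set S := Algebra.adjoin R (Set.range (ι R : L → UniversalEnvelopingAlgebra R L))
  let f : L →ₗ⁅R⁆ S :=
    { toFun := fun x => ⟨ι R x, Algebra.subset_adjoin ⟨x, rfl⟩⟩
      map_add' := fun x y => Subtype.ext (by simp)
      map_smul' := fun c x => Subtype.ext (by simp)
      map_lie' := fun {x y} => Subtype.ext (by
        simp [LieRing.of_associative_ring_bracket]) }
  have h : S.val.comp (lift R f) = AlgHom.id R _ := by
    ext x
    change S.val (lift R f (ι R x)) = ι R x
    rw [lift_ι_apply]
    rfl
  rw [eq_top_iff]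
  intro u _
  have := congrArg (fun g => g u) h
  simp only [AlgHom.comp_apply, AlgHom.id_apply] at this
  rw [← this]
  exact (lift R f u).2

lemma induction_on {p : UniversalEnvelopingAlgebra R L → Prop}
    (hι : ∀ x, p (ι R x)) (halg : ∀ r, p (algebraMap R _ r))
    (hadd : ∀ a b, p a → p b → p (a + b)) (hmul : ∀ a b, p a → p b → p (a * b))
    (u : UniversalEnvelopingAlgebra R L) : p u := by
  have hu : u ∈ Algebra.adjoin R (Set.range (ι R : L → UniversalEnvelopingAlgebra R L)) := by
    rw [adjoin_range_ι]; trivial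
  induction hu using Algebra.adjoin_induction with
  | mem x hx => obtain ⟨y, rfl⟩ := hx; exact hι y
  | algebraMap r => exact halg r
  | add a b _ _ ha hb => exact hadd a b ha hb
  | mul a b _ _ ha hb => exact hmul a b ha hb

/-- The product in `U(L)` of the letters of a word in the elements `X i`. -/
def wprod (X : κ → L) (w : List κ) : UniversalEnvelopingAlgebra R L :=
  (w.map fun i => ι R (X i)).prod

@[simp] lemma wprod_nil (X : κ → L) : wprod R X [] = 1 := rfl

@[simp] lemma wprod_cons (X : κ → L) (i : κ) (w : List κ) :
    wprod R X (i :: w) = ι R (X i) * wprod R X w := by simp [wprod]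

lemma wprod_append (X : κ → L) (v w : List κ) :
    wprod R X (v ++ w) = wprod R X v * wprod R X w := by simp [wprod]

/-- The span of the products of at most `k` of the elements `X i`. -/
def lengthFiltration (X : κ → L) (k : ℕ) : Submodule R (UniversalEnvelopingAlgebra R L) :=
  Submodule.span R {u | ∃ w : List κ, w.length ≤ k ∧ u = wprod R X w}

lemma ι_mul_mem_span {X : κ → L} (hX : Submodule.span R (Set.range X) = ⊤) (s t : Set (List κ))
    (hst : ∀ i, ∀ w ∈ s, i :: w ∈ t) (x : L) {u : UniversalEnvelopingAlgebra R L}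
    (hu : u ∈ Submodule.span R (wprod R X '' s)) :
    ι R x * u ∈ Submodule.span R (wprod R X '' t) := by
  have hx : x ∈ Submodule.span R (Set.range X) := by rw [hX]; trivial
  induction hx using Submodule.span_induction with
  | mem x hx =>
    obtain ⟨i, rfl⟩ := hx
    induction hu using Submodule.span_induction with
    | mem u hu =>
      obtain ⟨w, hw, rfl⟩ := hu
      exact Submodule.subset_span ⟨i :: w, hst i w hw, by simp⟩
    | zero => simp
    | add a b _ _ ha hb => rw [mul_add]; exact add_mem ha hb
    | smul c a _ ha => rw [mul_smul_comm]; exact Submodule.smul_mem _ _ ha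
  | zero => simp
  | add a b _ _ ha hb => rw [map_add, add_mul]; exact add_mem ha hb
  | smul c a _ ha => rw [map_smul, smul_mul_assoc]; exact Submodule.smul_mem _ _ ha

lemma lengthFiltration_eq (X : κ → L) (k : ℕ) :
    lengthFiltration R X k = Submodule.span R (wprod R X '' {w | w.length ≤ k}) := by
  unfold lengthFiltration
  congr 1
  ext u
  simp [eq_comm]

lemma ι_mul_mem_lengthFiltration {X : κ → L} (hX : Submodule.span R (Set.range X) = ⊤) (k : ℕ)
    (x : L) {u : UniversalEnvelopingAlgebra R L} (hu : u ∈ lengthFiltration R X k) :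
    ι R x * u ∈ lengthFiltration R X (k + 1) := by
  rw [lengthFiltration_eq] at *
  exact ι_mul_mem_span R hX _ _ (fun i w hw => by simpa using hw) x hu

lemma span_range_wprod {X : κ → L} (hX : Submodule.span R (Set.range X) = ⊤) :
    Submodule.span R (Set.range (wprod R X)) = ⊤ := by
  rw [eq_top_iff]
  intro u hu
  clear hu
  rw [← Set.image_univ]
  have h : ∀ v ∈ Submodule.span R (wprod R X '' Set.univ),
      u * v ∈ Submodule.span R (wprod R X '' Set.univ) := by
    induction u using induction_on R with
    | hι x => exact fun v hv => ι_mul_mem_span R hX _ _ (fun _ _ _ => Set.mem_univ _) x hv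
    | halg r =>
      intro v hv
      rw [← Algebra.smul_def]
      exact Submodule.smul_mem _ _ hv
    | hadd a b ha hb => intro v hv; rw [add_mul]; exact add_mem (ha v hv) (hb v hv)
    | hmul a b ha hb => intro v hv; rw [mul_assoc]; exact ha _ (hb v hv)
  simpa using h 1 (Submodule.subset_span ⟨[], trivial, rfl⟩)

/-- Swapping two adjacent letters costs a bracket, which is a single element of `L`, so the error
has one letter fewer. -/
lemma wprod_sub_mem_of_perm {X : κ → L} (hX : Submodule.span R (Set.range X) = ⊤)
    {v w : List κ} (h : v.Perm w) (k : ℕ) (hk : v.length ≤ k + 1) :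
    wprod R X v - wprod R X w ∈ lengthFiltration R X k := by
  induction h generalizing k with
  | nil => simp
  | @cons x l₁ l₂ h ih =>
    rw [wprod_cons, wprod_cons, ← mul_sub]
    obtain _ | k := k
    · obtain rfl : l₁ = [] := List.eq_nil_of_length_eq_zero (by simpa using hk)
      obtain rfl : l₂ = [] := h.symm.eq_nil
      simp
    · exact ι_mul_mem_lengthFiltration R hX k _ (ih k (by simpa using hk))
  | swap x y l =>
    have e : wprod R X (y :: x :: l) - wprod R X (x :: y :: l) =
        ι R ⁅X y, X x⁆ * wprod R X l := by
      simp only [wprod_cons, LieHom.map_lie, LieRing.of_associative_ring_bracket, sub_mul, mul_assoc]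
    rw [e]
    simp only [List.length_cons, Nat.add_le_add_iff_right] at hk
    obtain ⟨k, rfl⟩ : ∃ j, k = j + 1 := ⟨k - 1, by omega⟩
    exact ι_mul_mem_lengthFiltration R hX k _ (Submodule.subset_span ⟨l, by omega, rfl⟩)
  | trans h₁ h₂ ih₁ ih₂ =>
    rw [← sub_add_sub_cancel]
    exact add_mem (ih₁ k hk) (ih₂ k (h₁.length_eq ▸ hk))

/-- The ordered monomials in a spanning set of `L` span `U(L)`. -/
theorem span_ordered_monomials {X : κ → L} (hX : Submodule.span R (Set.range X) = ⊤)
    {ℓ : List κ} (hnd : ℓ.Nodup) (hmem : ∀ i, i ∈ ℓ) :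
    Submodule.span R (Set.range fun d => wprod R X (word ℓ d)) = ⊤ := by
  classical
  -- Induction on length: a word differs from its sorted form by an element of the previous
  -- filtration step.
  have key : ∀ k, lengthFiltration R X k ≤
      Submodule.span R (Set.range fun d => wprod R X (word ℓ d)) := by
    have hperm : ∀ w : List κ, w.Perm (word ℓ (Multiset.toFinsupp (w : Multiset κ))) := by
      intro w
      rw [List.perm_iff_count]
      intro a
      rw [count_word hnd]
      simp [hmem]
    intro k
    induction k with
    | zero =>
      refine Submodule.span_le.2 ?_
      rintro _ ⟨w, hw, rfl⟩
      obtain rfl : w = [] := List.eq_nil_of_length_eq_zero (by simpa using hw)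
      refine Submodule.subset_span ⟨0, ?_⟩
      have h0 : word ℓ 0 = [] := by simp [word, List.flatMap_eq_nil_iff]
      exact congrArg _ h0
    | succ k ih =>
      refine Submodule.span_le.2 ?_
      rintro _ ⟨w, hw, rfl⟩
      have h := add_mem (ih (wprod_sub_mem_of_perm R hX (hperm w) k hw))
        (Submodule.subset_span ⟨_, rfl⟩ : wprod R X (word ℓ (Multiset.toFinsupp (w : Multiset κ))) ∈
          Submodule.span R (Set.range fun d => wprod R X (word ℓ d)))
      simpa using h
  rw [eq_top_iff, ← span_range_wprod R hX]
  refine Submodule.span_le.2 ?_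
  rintro _ ⟨w, rfl⟩
  exact key w.length (Submodule.subset_span ⟨w, le_rfl, rfl⟩)

end UEAWords

end

/-! ### Poincaré–Birkhoff–Witt: independence for Lie algebras of matrices -/

noncomputable section

namespace UEAWords

attribute [local instance 100] LieRing.ofAssociativeRing

open UniversalEnvelopingAlgebra MvPolynomial

section Derivations

variable {K : Type*} [Field K] {n : Type*} [Fintype n]

/-- The derivation of the ring of functions of `1 + y`, `y` a matrix, given by right translation:
`y ↦ (1 + y) A`. -/
def translationDerivation (A : Matrix n n K) :
    Derivation K (MvPolynomial (n × n) K) (MvPolynomial (n × n) K) :=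
  mkDerivation K fun p => C (A p.1 p.2) + ∑ k, X (p.1, k) * C (A k p.2)

lemma translationDerivation_X (A : Matrix n n K) (i j : n) :
    translationDerivation A (X (i, j)) = C (A i j) + ∑ k, X (i, k) * C (A k j) :=
  mkDerivation_X _ _ _

/-- Applying the derivation of `B` and then that of `A` sends `1 + y` to `(1 + y) A B`, so
commutators of derivations match commutators of matrices in the right order. -/
lemma translationDerivation_comp (A B : Matrix n n K) (i j : n) :
    translationDerivation A (translationDerivation B (X (i, j))) =
      C ((A * B) i j) + ∑ k, X (i, k) * C ((A * B) k j) := by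
  rw [translationDerivation_X, map_add, map_sum]
  have h : ∀ k, translationDerivation A (X (i, k) * C (B k j)) =
      C (A i k * B k j) + ∑ l, X (i, l) * C (A l k * B k j) := by
    intro k
    rw [Derivation.leibniz, derivation_C, translationDerivation_X, smul_zero, zero_add, smul_eq_mul,
      mul_comm, add_mul, Finset.sum_mul, map_mul]
    simp only [map_mul, mul_assoc]
  simp only [h, derivation_C, zero_add, Finset.sum_add_distrib, Matrix.mul_apply, map_sum,
    Finset.mul_sum]
  rw [Finset.sum_comm]

/-- The action of matrices by the derivations `translationDerivation`. -/
def translationRep [DecidableEq n] : Matrix n n K →ₗ⁅K⁆ Module.End K (MvPolynomial (n × n) K) where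
  toFun A := (translationDerivation A).toLinearMap
  map_add' A B := by
    have h : translationDerivation (A + B) = translationDerivation A + translationDerivation B := by
      refine derivation_ext fun p => ?_
      obtain ⟨i, j⟩ := p
      simp only [Derivation.add_apply, translationDerivation_X, Matrix.add_apply, map_add, mul_add,
        Finset.sum_add_distrib]
      ring
    rw [h]; rfl
  map_smul' c A := by
    have h : translationDerivation (c • A) = c • translationDerivation A := by
      refine derivation_ext fun p => ?_
      obtain ⟨i, j⟩ := p
      simp only [Derivation.smul_apply, translationDerivation_X, Matrix.smul_apply, smul_eq_mul,
        map_mul, smul_add, Finset.smul_sum, MvPolynomial.smul_eq_C_mul]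
      congr 1
      exact Finset.sum_congr rfl fun k _ => by ring
    rw [h]; rfl
  map_lie' {A B} := by
    have h : translationDerivation ⁅A, B⁆ = ⁅translationDerivation A, translationDerivation B⁆ := by
      refine derivation_ext fun p => ?_
      obtain ⟨i, j⟩ := p
      rw [Derivation.commutator_apply, translationDerivation_comp, translationDerivation_comp,
        translationDerivation_X]
      simp only [LieRing.of_associative_ring_bracket, Matrix.sub_apply, map_sub, mul_sub,
        Finset.sum_sub_distrib]
      ring
    rw [h]
    ext1 f
    simp [LieRing.of_associative_ring_bracket]

lemma translationRep_apply [DecidableEq n] (A : Matrix n n K) (f : MvPolynomial (n × n) K) :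
    translationRep A f = translationDerivation A f := rfl

/-- The ideal of polynomials without constant term. -/
abbrev augIdeal (σ K : Type*) [Field K] : Ideal (MvPolynomial σ K) :=
  RingHom.ker (constantCoeff : MvPolynomial σ K →+* K)

lemma derivation_mem_pow {σ : Type*} (D : Derivation K (MvPolynomial σ K) (MvPolynomial σ K))
    (I : Ideal (MvPolynomial σ K)) (k : ℕ)
    {f : MvPolynomial σ K} (hf : f ∈ I ^ (k + 1)) : D f ∈ I ^ k := by
  induction k generalizing f with
  | zero => simp
  | succ k ih =>
    rw [pow_succ' I (k + 1)] at hf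
    induction hf using Submodule.mul_induction_on' with
    | mem_mul_mem a ha b hb =>
      rw [Derivation.leibniz, smul_eq_mul, smul_eq_mul]
      refine add_mem ?_ (Ideal.mul_mem_right _ _ hb)
      rw [pow_succ' I k]
      exact Ideal.mul_mem_mul ha (ih hb)
    | add a _ b _ ha hb => rw [map_add]; exact add_mem ha hb

variable [DecidableEq n]

/-- A derivation lowers the order of vanishing at the identity matrix `y = 0` by at most one. The
induction peels off the last letter because it acts first. -/
lemma constantCoeff_prod_eq_zero (w : List (Matrix n n K)) (k : ℕ) (hk : w.length < k)
    {f : MvPolynomial (n × n) K} (hf : f ∈ augIdeal (n × n) K ^ k) :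
    constantCoeff ((w.map translationRep).prod f) = 0 := by
  induction w using List.reverseRecOn generalizing k f with
  | nil =>
    obtain ⟨k, rfl⟩ : ∃ j, k = j + 1 := ⟨k - 1, by simp at hk; omega⟩
    simpa using Ideal.pow_le_self (Nat.succ_ne_zero k) hf
  | append_singleton w A ih =>
    obtain ⟨k, rfl⟩ : ∃ j, k = j + 1 := ⟨k - 1, by simp at hk; omega⟩
    simp only [List.map_append, List.map_cons, List.map_nil, List.prod_append, List.prod_singleton,
      Module.End.mul_apply]
    exact ih k (by simpa using hk) (derivation_mem_pow _ _ k hf)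

/-- The linear form in the coordinates of a matrix with the coefficients of `ξ`. -/
def linearForm (ξ : Module.Dual K (Matrix n n K)) : MvPolynomial (n × n) K :=
  ∑ p : n × n, C (ξ (Matrix.single p.1 p.2 1)) * X p

lemma linearForm_mem (ξ : Module.Dual K (Matrix n n K)) : linearForm ξ ∈ augIdeal (n × n) K := by
  simp [linearForm, RingHom.mem_ker]

lemma translationDerivation_linearForm (ξ : Module.Dual K (Matrix n n K)) (A : Matrix n n K) :
    translationDerivation A (linearForm ξ) - C (ξ A) ∈ augIdeal (n × n) K := by
  have h : ξ A = ∑ i, ∑ j, ξ (Matrix.single i j 1) * A i j := by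
    conv_lhs => rw [Matrix.matrix_eq_sum_single A]
    simp only [map_sum]
    refine Finset.sum_congr rfl fun i _ => Finset.sum_congr rfl fun j _ => ?_
    rw [← mul_one (A i j), ← smul_eq_mul, ← Matrix.smul_single, map_smul, smul_eq_mul, smul_eq_mul,
      mul_one, mul_comm]
  rw [RingHom.mem_ker, map_sub, constantCoeff_C, h, linearForm, map_sum, map_sum, sub_eq_zero,
    ← Fintype.sum_prod_type']
  refine Finset.sum_congr rfl fun p _ => ?_
  obtain ⟨i, j⟩ := p
  simp [Derivation.leibniz, translationDerivation_X]

/-- To leading order each derivation acts on a power of a linear form as differentiation in a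
constant direction, and the lower-order corrections vanish too fast to contribute. -/
lemma constantCoeff_prod_linearForm (ξ : Module.Dual K (Matrix n n K)) (w : List (Matrix n n K)) :
    constantCoeff ((w.map translationRep).prod (linearForm ξ ^ w.length)) =
      (w.length.factorial : K) * (w.map ξ).prod := by
  induction w using List.reverseRecOn with
  | nil => simp
  | append_singleton w A ih =>
    simp only [List.map_append, List.map_cons, List.map_nil, List.prod_append, List.prod_singleton,
      Module.End.mul_apply, List.length_append, List.length_cons, List.length_nil, zero_add]
    have e : translationRep A (linearForm ξ ^ (w.length + 1)) =
        (((w.length + 1 : ℕ) : K) * ξ A) • linearForm ξ ^ w.length +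
        ((w.length + 1 : ℕ) : MvPolynomial (n × n) K) * (linearForm ξ ^ w.length *
          (translationDerivation A (linearForm ξ) - C (ξ A))) := by
      rw [translationRep_apply, Derivation.leibniz_pow, Nat.add_sub_cancel,
        MvPolynomial.smul_eq_C_mul, map_mul, map_natCast]
      simp only [nsmul_eq_mul, smul_eq_mul]
      ring
    have hm : ((w.length + 1 : ℕ) : MvPolynomial (n × n) K) * (linearForm ξ ^ w.length *
          (translationDerivation A (linearForm ξ) - C (ξ A))) ∈
          augIdeal (n × n) K ^ (w.length + 1) := by
      refine Ideal.mul_mem_left _ _ ?_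
      rw [pow_succ]
      exact Ideal.mul_mem_mul (Ideal.pow_mem_pow (linearForm_mem ξ) _)
        (translationDerivation_linearForm ξ A)
    rw [e, map_add, map_add, constantCoeff_prod_eq_zero w _ (Nat.lt_succ_self _) hm, map_smul,
      MvPolynomial.constantCoeff_smul, ih, Nat.factorial_succ]
    push_cast
    simp only [smul_eq_mul]
    ring

end Derivations

/-- The ordered monomials in linearly independent elements of a Lie algebra of matrices are linearly
independent in its universal enveloping algebra. -/
theorem linearIndependent_ordered_monomials {K : Type*} [Field K] [CharZero K] {n : Type*}
    [Fintype n] [DecidableEq n] {L : Type*} [LieRing L] [LieAlgebra K L]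
    (ρ : L →ₗ⁅K⁆ Matrix n n K) {κ : Type*} [Fintype κ] {x : κ → L}
    (hx : LinearIndependent K fun i => ρ (x i)) {ℓ : List κ} (hnd : ℓ.Nodup)
    (hmem : ∀ i, i ∈ ℓ) : LinearIndependent K fun d => wprod K x (word ℓ d) := by
  classical
  let F : UniversalEnvelopingAlgebra K L →ₐ[K] Module.End K (MvPolynomial (n × n) K) :=
    lift K (translationRep.comp ρ)
  have hF : ∀ w : List κ, F (wprod K x w) = ((w.map fun i => ρ (x i)).map translationRep).prod := by
    intro w
    rw [wprod, map_list_prod, List.map_map, List.map_map]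
    congr 1
    refine List.map_congr_left fun i _ => ?_
    change lift K (translationRep.comp ρ) (ι K (x i)) = _
    rw [lift_ι_apply]
    rfl
  rw [linearIndependent_iff]
  intro c hc
  by_contra hne
  -- Only the top-degree part of the relation survives when tested on `N`-th powers of linear forms;
  -- `q` below is its symbol.
  obtain ⟨d₀, hd₀, hmax⟩ := c.support.exists_max_image Finsupp.degree
    (Finsupp.support_nonempty_iff.2 hne)
  set N := d₀.degree with hN
  let q : MvPolynomial κ K := ∑ d ∈ c.support with d.degree = N, monomial d (c d)
  have hq : q = 0 := by
    refine MvPolynomial.funext fun t => ?_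
    -- Independence of the matrices yields a functional with arbitrary prescribed values `t` on
    -- them, so `q` vanishes at every point.
    obtain ⟨g, hg⟩ := LinearMap.exists_leftInverse_of_injective
      (Finsupp.linearCombination K fun i => ρ (x i)) (LinearMap.ker_eq_bot.2 hx)
    let ξ : Module.Dual K (Matrix n n K) := (Finsupp.linearCombination K t).comp g
    have hξ : ∀ i, ξ (ρ (x i)) = t i := by
      intro i
      have := congrArg (fun f => f (Finsupp.single i 1)) hg
      simp only [LinearMap.comp_apply, Finsupp.linearCombination_single, one_smul,
        LinearMap.id_apply] at this
      simp [ξ, this]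
    have hterm : ∀ d ∈ c.support,
        constantCoeff (F (c d • wprod K x (word ℓ d)) (linearForm ξ ^ N)) =
          if d.degree = N then (N.factorial : K) * eval t (monomial d (c d)) else 0 := by
      intro d hd
      have hlen : ((word ℓ d).map fun i => ρ (x i)).length = d.degree := by
        rw [List.length_map, length_word hnd hmem]
      rw [map_smul, LinearMap.smul_apply, MvPolynomial.constantCoeff_smul, hF]
      split_ifs with h
      · rw [← h, ← hlen, constantCoeff_prod_linearForm, List.map_map, hlen]
        have : (ξ ∘ fun i => ρ (x i)) = t := _root_.funext hξ
        rw [this, prod_map_word hnd hmem, eval_monomial, Finsupp.prod_fintype _ _ (by simp),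
          smul_eq_mul]
        ring
      · rw [constantCoeff_prod_eq_zero _ N _ (Ideal.pow_mem_pow (linearForm_mem ξ) _), smul_zero]
        rw [hlen]
        exact lt_of_le_of_ne (hmax d hd) h
    have h0 := congrArg (fun u => constantCoeff (F u (linearForm ξ ^ N))) hc
    simp only [Finsupp.linearCombination_apply, Finsupp.sum, map_sum, LinearMap.sum_apply,
      map_zero, LinearMap.zero_apply] at h0
    rw [Finset.sum_congr rfl hterm, ← Finset.sum_filter, ← Finset.mul_sum] at h0
    rw [map_sum, map_zero]
    exact (mul_eq_zero.1 h0).resolve_left (Nat.cast_ne_zero.2 (Nat.factorial_ne_zero N))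
  have h1 : coeff d₀ q = c d₀ := by
    rw [coeff_sum, Finset.sum_eq_single d₀]
    · simp
    · intro d _ hd; simp [coeff_monomial, hd]
    · intro h; exact absurd (Finset.mem_filter.2 ⟨hd₀, hN.symm⟩) h
  rw [hq, coeff_zero] at h1
  exact Finsupp.mem_support_iff.1 hd₀ h1.symm

end UEAWords

end

/-! ### Triangular decomposition of `𝔰𝔩ₘ` and the projection of its enveloping algebra -/

noncomputable section

namespace VermaSl

open UEAWords UniversalEnvelopingAlgebra Module

attribute [local instance 100] LieRing.ofAssociativeRing

variable {m : ℕ}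

/-- The negative roots `eᵢ - eⱼ`, `i > j`, as pairs `(i, j)`. -/
abbrev NegRoot (m : ℕ) : Type := {p : Fin m × Fin m // p.2 < p.1}

/-- The Borel subalgebra of upper triangular matrices. -/
def borel (m : ℕ) : LieSubalgebra ℂ (SL m) where
  carrier := {x | x.val.BlockTriangular id}
  add_mem' hx hy := hx.add hy
  zero_mem' := Matrix.blockTriangular_zero
  smul_mem' c x hx := fun i j h => by
    change c * x.val i j = 0
    rw [hx h, mul_zero]
  lie_mem' {x y} hx hy := by
    change (x.val * y.val - y.val * x.val).BlockTriangular id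
    exact (hx.mul hy).sub (hy.mul hx)

lemma borel_apply (x : borel m) {i j : Fin m} (h : j < i) : x.val.val i j = 0 := x.2 h

lemma trace_eq_zero (x : SL m) : ∑ i, x.val i i = 0 := x.2

/-- The diagonal part of an upper triangular matrix. -/
def diagPart : borel m →ₗ[ℂ] cartan m where
  toFun x := ⟨⟨Matrix.diagonal fun i => x.val.val i i, by
    change Matrix.trace (n := Fin m) _ = 0
    rw [Matrix.trace_diagonal]
    exact trace_eq_zero x.val⟩, Matrix.isDiag_diagonal _⟩
  map_add' x y := Subtype.ext (Subtype.ext (Matrix.diagonal_add _ _).symm)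
  map_smul' c x := Subtype.ext (Subtype.ext (Matrix.diagonal_smul c _))

lemma diagPart_val (x : borel m) :
    (diagPart x).val.val = Matrix.diagonal fun i => x.val.val i i := rfl

lemma mul_diag_entry {A B : Matrix (Fin m) (Fin m) ℂ} (hA : A.BlockTriangular id)
    (hB : B.BlockTriangular id) (i : Fin m) : (A * B) i i = A i i * B i i := by
  rw [Matrix.mul_apply, Finset.sum_eq_single i]
  · intro k _ hk
    rcases lt_or_gt_of_ne hk with h | h
    · rw [hA h, zero_mul]
    · rw [hB h, mul_zero]
  · simp

lemma diagPart_lie (x y : borel m) : diagPart ⁅x, y⁆ = 0 := by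
  apply Subtype.ext
  apply Subtype.ext
  rw [diagPart_val]
  change Matrix.diagonal (fun i => (x.val.val * y.val.val - y.val.val * x.val.val) i i) = 0
  rw [← Matrix.diagonal_zero]
  congr 1
  funext i
  rw [Matrix.sub_apply, mul_diag_entry x.2 y.2, mul_diag_entry y.2 x.2]
  ring

/-- The character of the Borel subalgebra determined by a weight. -/
def borelCharacter (l : weightLattice m) : borel m →ₗ⁅ℂ⁆ ℂ :=
  { l.val.comp diagPart with
    map_lie' := fun {x y} => by
      change l.val (diagPart ⁅x, y⁆) = ⁅l.val (diagPart x), l.val (diagPart y)⁆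
      rw [diagPart_lie, map_zero, LieRing.of_associative_ring_bracket]
      ring }

lemma borelCharacter_apply (l : weightLattice m) (x : borel m) :
    borelCharacter l x = l.val (diagPart x) := rfl

/-- The strictly lower triangular matrix with given entries. -/
def lowering : (NegRoot m → ℂ) →ₗ[ℂ] SL m where
  toFun a := ⟨Matrix.of fun i j => if h : j < i then a ⟨(i, j), h⟩ else 0, by
    change Matrix.trace (n := Fin m) _ = 0
    simp [Matrix.trace]⟩
  map_add' a b := by
    apply Subtype.ext; ext i j
    change (if h : j < i then (a + b) ⟨(i, j), h⟩ else 0) =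
      (if h : j < i then a ⟨(i, j), h⟩ else 0) + (if h : j < i then b ⟨(i, j), h⟩ else 0)
    split_ifs <;> simp
  map_smul' c a := by
    apply Subtype.ext; ext i j
    change (if h : j < i then (c • a) ⟨(i, j), h⟩ else 0) =
      c * (if h : j < i then a ⟨(i, j), h⟩ else 0)
    split_ifs <;> simp

lemma lowering_apply (a : NegRoot m → ℂ) (i j : Fin m) :
    (lowering a).val i j = if h : j < i then a ⟨(i, j), h⟩ else 0 := rfl

/-- The decomposition of `𝔰𝔩ₘ` into strictly lower and upper triangular matrices. -/
def triangularEquiv (m : ℕ) : ((NegRoot m → ℂ) × borel m) ≃ₗ[ℂ] SL m where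
  toFun p := lowering p.1 + p.2.val
  map_add' p q := by
    change lowering (p.1 + q.1) + (p.2.val + q.2.val) = _
    rw [map_add]
    abel
  map_smul' c p := by
    simp
  invFun x := (fun p => x.val p.val.1 p.val.2, ⟨x - lowering fun p => x.val p.val.1 p.val.2, by
    intro i j h
    change x.val i j - (lowering fun p => x.val p.val.1 p.val.2).val i j = 0
    rw [lowering_apply, dif_pos (show j < i from h), sub_self]⟩)
  left_inv p := by
    have h : (fun q : NegRoot m => (lowering p.1 + p.2.val).val q.val.1 q.val.2) = p.1 := by
      funext q
      change (lowering p.1).val _ _ + p.2.val.val _ _ = _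
      rw [borel_apply _ q.2, lowering_apply, dif_pos q.2, add_zero]
    refine Prod.ext h (Subtype.ext ?_)
    change lowering p.1 + p.2.val - lowering (fun q : NegRoot m => _) = p.2.val
    rw [h, add_sub_cancel_left]
  right_inv x := by
    simp

/-- The matrix unit of a negative root. -/
def lowerUnit (p : NegRoot m) : SL m := lowering (Pi.single p 1)

lemma lowerUnit_apply (p : NegRoot m) (i j : Fin m) :
    (lowerUnit p).val i j = if (i, j) = p.val then 1 else 0 := by
  rw [lowerUnit, lowering_apply]
  split_ifs with h h1 h1
  · have : (⟨(i, j), h⟩ : NegRoot m) = p := Subtype.ext h1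
    rw [this, Pi.single_eq_same]
  · rw [Pi.single_eq_of_ne]
    intro h2
    exact h1 (congrArg Subtype.val h2)
  · have h2 := p.2
    rw [← h1] at h2
    exact absurd h2 h
  · rfl

lemma lie_lowerUnit (h : cartan m) (p : NegRoot m) :
    ⁅(h : SL m), lowerUnit p⁆ = ((e p.val.1 - e p.val.2 : weightLattice m).val h) • lowerUnit p := by
  apply Subtype.ext
  ext i j
  have hd : h.val.val = Matrix.diagonal h.val.val.diag := ((Matrix.isDiag_iff_diagonal_diag _).1 h.2).symm
  change (h.val.val * (lowerUnit p).val - (lowerUnit p).val * h.val.val) i j =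
    (h.val.val p.val.1 p.val.1 - h.val.val p.val.2 p.val.2) * (lowerUnit p).val i j
  rw [Matrix.sub_apply, hd, Matrix.diagonal_mul, Matrix.mul_diagonal, lowerUnit_apply]
  simp only [Matrix.diag_apply, Matrix.diagonal_apply_eq]
  split_ifs with h1
  · rw [← h1]; ring
  · ring

/-- The index set of the basis of `𝔰𝔩ₘ` made of a basis of the Borel subalgebra and the matrix units of
the negative roots. -/
abbrev BasisIndex (m : ℕ) : Type := NegRoot m ⊕ Fin (finrank ℂ (borel m))

/-- The basis of `𝔰𝔩ₘ` made of the matrix units of the negative roots and of a basis of the Borel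
subalgebra. -/
def triangularBasis (m : ℕ) : Basis (BasisIndex m) ℂ (SL m) :=
  ((Pi.basisFun ℂ (NegRoot m)).prod (finBasis ℂ (borel m))).map (triangularEquiv m)

lemma triangularBasis_inl (p : NegRoot m) : triangularBasis m (Sum.inl p) = lowerUnit p := by
  simp [triangularBasis, triangularEquiv, lowerUnit]

lemma triangularBasis_inr (i : Fin (finrank ℂ (borel m))) :
    triangularBasis m (Sum.inr i) = (finBasis ℂ (borel m) i : SL m) := by
  simp [triangularBasis, triangularEquiv]

/-- The map `U(𝔟) → U(𝔰𝔩ₘ)`. -/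
def envelopingIncl (m : ℕ) :
    UniversalEnvelopingAlgebra ℂ (borel m) →ₐ[ℂ] UniversalEnvelopingAlgebra ℂ (SL m) :=
  lift ℂ ((ι ℂ).comp (borel m).incl)

lemma envelopingIncl_ι (x : borel m) : envelopingIncl m (ι ℂ x) = ι ℂ (x : SL m) := by
  rw [envelopingIncl, lift_ι_apply]; rfl

/-- The ordered monomial in the negative root vectors with the given exponents. -/
def lowerMonomial (a : NegRoot m →₀ ℕ) : UniversalEnvelopingAlgebra ℂ (SL m) :=
  wprod ℂ lowerUnit (word (Finset.univ : Finset (NegRoot m)).toList a)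

/-- The ordered monomial in the basis of the Borel subalgebra with the given exponents. -/
def borelMonomial (c : Fin (finrank ℂ (borel m)) →₀ ℕ) : UniversalEnvelopingAlgebra ℂ (borel m) :=
  wprod ℂ (finBasis ℂ (borel m)) (word (List.finRange _) c)

/-- The list of indices, negative roots first. -/
def indexList (m : ℕ) : List (BasisIndex m) :=
  (Finset.univ : Finset (NegRoot m)).toList.map Sum.inl ++ (List.finRange _).map Sum.inr

lemma nodup_indexList (m : ℕ) : (indexList m).Nodup := by
  refine List.Nodup.append ((Finset.nodup_toList _).map Sum.inl_injective)
    ((List.nodup_finRange _).map Sum.inr_injective) ?_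
  intro x hx hy
  obtain ⟨a, _, rfl⟩ := List.mem_map.1 hx
  obtain ⟨b, _, hb⟩ := List.mem_map.1 hy
  cases hb

lemma mem_indexList (i : BasisIndex m) : i ∈ indexList m := by
  cases i <;> simp [indexList]

lemma wprod_map {R L κ κ' : Type*} [CommRing R] [LieRing L] [LieAlgebra R L] (X : κ → L)
    (f : κ' → κ) (w : List κ') : wprod R X (w.map f) = wprod R (X ∘ f) w := by
  simp [wprod, Function.comp_def]

/-- Listing the negative roots first makes every ordered monomial split into a factor from `U(𝔫⁻)`
and one from `U(𝔟)`. -/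
lemma wprod_indexList (d : BasisIndex m →₀ ℕ) :
    wprod ℂ (triangularBasis m) (word (indexList m) d) =
      lowerMonomial (Finsupp.sumFinsuppEquivProdFinsupp d).1 *
        envelopingIncl m (borelMonomial (Finsupp.sumFinsuppEquivProdFinsupp d).2) := by
  have h : word (indexList m) d =
      (word (Finset.univ : Finset (NegRoot m)).toList
        (Finsupp.sumFinsuppEquivProdFinsupp d).1).map Sum.inl ++
      (word (List.finRange _) (Finsupp.sumFinsuppEquivProdFinsupp d).2).map Sum.inr := by
    simp [word, indexList, List.map_flatMap, List.flatMap_map]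
  rw [h, wprod_append, wprod_map, wprod_map, lowerMonomial, borelMonomial]
  congr 1
  · congr 1
    funext p
    exact triangularBasis_inl p
  · rw [wprod, wprod, map_list_prod, List.map_map]
    congr 1
    refine List.map_congr_left fun i _ => ?_
    simp only [Function.comp_apply]
    rw [envelopingIncl_ι, triangularBasis_inr]

lemma linearIndependent_triangularMonomials (m : ℕ) :
    LinearIndependent ℂ fun d => wprod ℂ (triangularBasis m) (word (indexList m) d) := by
  have h : LinearIndependent ℂ fun i => (SL m).incl (triangularBasis m i) :=
    (triangularBasis m).linearIndependent.map' (SL m).toSubmodule.subtype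
      (Submodule.ker_subtype _)
  exact linearIndependent_ordered_monomials (SL m).incl h (nodup_indexList m) mem_indexList

lemma span_triangularMonomials (m : ℕ) :
    Submodule.span ℂ (Set.range fun d => wprod ℂ (triangularBasis m) (word (indexList m) d)) = ⊤ :=
  span_ordered_monomials ℂ (triangularBasis m).span_eq (nodup_indexList m) mem_indexList

/-- The basis of `U(𝔰𝔩ₘ)` made of the products of monomials in the negative root vectors with monomials
in a basis of the Borel subalgebra. -/
def envelopingBasis (m : ℕ) :
    Basis (BasisIndex m →₀ ℕ) ℂ (UniversalEnvelopingAlgebra ℂ (SL m)) :=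
  Basis.mk (linearIndependent_triangularMonomials m) (span_triangularMonomials m).ge

lemma envelopingBasis_apply (d : BasisIndex m →₀ ℕ) :
    envelopingBasis m d = lowerMonomial (Finsupp.sumFinsuppEquivProdFinsupp d).1 *
        envelopingIncl m (borelMonomial (Finsupp.sumFinsuppEquivProdFinsupp d).2) := by
  rw [envelopingBasis, Basis.mk_apply, wprod_indexList]

lemma span_borelMonomial (m : ℕ) :
    Submodule.span ℂ (Set.range (borelMonomial (m := m))) = ⊤ :=
  span_ordered_monomials ℂ (finBasis ℂ (borel m)).span_eq (List.nodup_finRange _)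
    (fun i => List.mem_finRange i)

/-- The extension of the character of the Borel subalgebra to its enveloping algebra. -/
def envelopingCharacter (l : weightLattice m) : UniversalEnvelopingAlgebra ℂ (borel m) →ₐ[ℂ] ℂ :=
  lift ℂ (borelCharacter l)

lemma envelopingCharacter_ι (l : weightLattice m) (x : borel m) :
    envelopingCharacter l (ι ℂ x) = l.val (diagPart x) := by
  rw [envelopingCharacter, lift_ι_apply, borelCharacter_apply]

/-- The projection of `U(𝔰𝔩ₘ) = U(𝔫⁻) ⊗ U(𝔟)` onto `U(𝔫⁻)` given by the character of `𝔟`. -/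
def lowerProjection (l : weightLattice m) :
    UniversalEnvelopingAlgebra ℂ (SL m) →ₗ[ℂ] ((NegRoot m →₀ ℕ) →₀ ℂ) :=
  (envelopingBasis m).constr ℂ fun d => Finsupp.single (Finsupp.sumFinsuppEquivProdFinsupp d).1
    (envelopingCharacter l (borelMonomial (Finsupp.sumFinsuppEquivProdFinsupp d).2))

/-- Both sides are linear in `y`, so monomials suffice; only the spanning half of PBW is needed for
the Borel subalgebra. -/
lemma lowerProjection_mul (l : weightLattice m) (a : NegRoot m →₀ ℕ)
    (y : UniversalEnvelopingAlgebra ℂ (borel m)) :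
    lowerProjection l (lowerMonomial a * envelopingIncl m y) =
      Finsupp.single a (envelopingCharacter l y) := by
  have hy : y ∈ Submodule.span ℂ (Set.range (borelMonomial (m := m))) := by
    rw [span_borelMonomial]; trivial
  induction hy using Submodule.span_induction with
  | mem y hy =>
    obtain ⟨c, rfl⟩ := hy
    have h := envelopingBasis_apply (Finsupp.sumFinsuppEquivProdFinsupp.symm (a, c))
    rw [Equiv.apply_symm_apply] at h
    rw [← h, lowerProjection, Basis.constr_basis, Equiv.apply_symm_apply]
  | zero => simp
  | add x y _ _ hx hy => simp only [map_add, mul_add, hx, hy, Finsupp.single_add]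
  | smul c x _ hx => simp only [map_smul, mul_smul_comm, hx, Finsupp.smul_single]

lemma lowerProjection_mul_eq_zero (l : weightLattice m) (u : UniversalEnvelopingAlgebra ℂ (SL m))
    {y : UniversalEnvelopingAlgebra ℂ (borel m)} (hy : envelopingCharacter l y = 0) :
    lowerProjection l (u * envelopingIncl m y) = 0 := by
  have hu : u ∈ Submodule.span ℂ (Set.range (envelopingBasis m)) := (envelopingBasis m).mem_span u
  induction hu using Submodule.span_induction with
  | zero => simp
  | mem u hu =>
    obtain ⟨i, rfl⟩ := hu
    rw [envelopingBasis_apply, mul_assoc, ← map_mul, lowerProjection_mul, map_mul, hy, mul_zero,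
      Finsupp.single_zero]
  | add a b _ _ ha hb => rw [add_mul, map_add, ha, hb, add_zero]
  | smul c a _ ha => rw [smul_mul_assoc, map_smul, ha, smul_zero]

end VermaSl

end

/-! ### Monomial basis and weight spaces of the Verma module -/

noncomputable section

namespace VermaSl

open UEAWords UniversalEnvelopingAlgebra Module

attribute [local instance 100] LieRing.ofAssociativeRing

variable {m : ℕ}

/-- Modulo the defining ideal of `M(λ)`, elements of `U(𝔟)` are scalars, given by the character `λ`. -/
lemma envelopingIncl_sub_mem_vermaIdeal (l : weightLattice m)
    (y : UniversalEnvelopingAlgebra ℂ (borel m)) :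
    envelopingIncl m y - algebraMap ℂ _ (envelopingCharacter l y) ∈ vermaIdeal l := by
  induction y using UEAWords.induction_on with
  | hι x =>
    rw [envelopingIncl_ι, envelopingCharacter_ι]
    have h1 : ι ℂ (x.val - (diagPart x : SL m)) ∈ vermaIdeal l := by
      refine Submodule.subset_span (Or.inl ⟨_, ?_, rfl⟩)
      intro i j hij
      change x.val.val i j - Matrix.diagonal (fun i => x.val.val i i) i j = 0
      rcases hij.lt_or_eq with h | rfl
      · rw [borel_apply x h, Matrix.diagonal_apply_ne _ h.ne', sub_zero]
      · rw [Matrix.diagonal_apply_eq, sub_self]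
    have h2 : ι ℂ (diagPart x : SL m) - algebraMap ℂ _ (l.val (diagPart x)) ∈ vermaIdeal l :=
      Submodule.subset_span (Or.inr ⟨_, rfl⟩)
    have h3 := add_mem h1 h2
    rwa [map_sub, sub_add_sub_cancel] at h3
  | halg r => simp
  | hadd a b ha hb =>
    have h := add_mem ha hb
    rwa [sub_add_sub_comm, ← map_add, ← map_add, ← map_add] at h
  | hmul a b ha hb =>
    -- With `χ` the character, `ab - χ(a)χ(b) = a(b - χ(b)) + χ(b)(a - χ(a))`, which uses left
    -- multiplication only.
    have h := add_mem (Submodule.smul_mem _ (envelopingIncl m a) hb)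
      (Submodule.smul_mem _ (algebraMap ℂ _ (envelopingCharacter l b)) ha)
    rw [smul_eq_mul, smul_eq_mul, mul_sub, mul_sub, ← Algebra.commutes, sub_add_sub_cancel,
      ← map_mul, ← map_mul, mul_comm (envelopingCharacter l b), ← map_mul] at h
    exact h

/-- The projection is not `U(𝔰𝔩ₘ)`-linear, so the induction over the left ideal carries an arbitrary
left factor `v`. On generators, the right factor comes from the kernel of the character of `U(𝔟)`.
-/
lemma lowerProjection_eq_zero (l : weightLattice m) {u : UniversalEnvelopingAlgebra ℂ (SL m)}
    (hu : u ∈ vermaIdeal l) : lowerProjection l u = 0 := by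
  have key : ∀ v, lowerProjection l (v * u) = 0 := by
    induction hu using Submodule.span_induction with
    | mem u hu =>
      intro v
      rcases hu with ⟨x, hx, rfl⟩ | ⟨h, rfl⟩
      · let y : borel m := ⟨x, fun i j hij => hx i j (le_of_lt hij)⟩
        have hy : envelopingCharacter l (ι ℂ y) = 0 := by
          rw [envelopingCharacter_ι]
          have : diagPart y = 0 := by
            apply Subtype.ext; apply Subtype.ext
            rw [diagPart_val]
            change _ = (0 : Matrix (Fin m) (Fin m) ℂ)
            rw [← Matrix.diagonal_zero]
            congr 1
            funext i
            exact hx i i le_rfl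
          rw [this, map_zero]
        have := lowerProjection_mul_eq_zero l v hy
        rwa [envelopingIncl_ι] at this
      · let y : borel m := ⟨h, fun i j hij => h.2 (ne_of_gt hij)⟩
        have hd : diagPart y = h := by
          apply Subtype.ext; apply Subtype.ext
          exact (Matrix.isDiag_iff_diagonal_diag _).1 h.2
        have hy : envelopingCharacter l (ι ℂ y - algebraMap ℂ _ (l.val h)) = 0 := by
          rw [map_sub, envelopingCharacter_ι, hd, AlgHom.commutes]
          exact sub_self _
        have := lowerProjection_mul_eq_zero l v hy
        rwa [map_sub, envelopingIncl_ι, AlgHom.commutes] at this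
    | zero => simp
    | add a b _ _ ha hb => intro v; rw [mul_add, map_add, ha, hb, add_zero]
    | smul c a _ ha => intro v; rw [smul_eq_mul, ← mul_assoc, ha]
  simpa using key 1

/-- The quotient map `U(𝔰𝔩ₘ) → M(λ)`. -/
def toVerma (l : weightLattice m) : UniversalEnvelopingAlgebra ℂ (SL m) →ₗ[ℂ] Verma l :=
  (vermaIdeal l).mkQ.restrictScalars ℂ

lemma toVerma_eq_zero (l : weightLattice m) {u : UniversalEnvelopingAlgebra ℂ (SL m)} :
    toVerma l u = 0 ↔ u ∈ vermaIdeal l := Submodule.Quotient.mk_eq_zero _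

lemma toVerma_mul (l : weightLattice m) (u v : UniversalEnvelopingAlgebra ℂ (SL m)) :
    toVerma l (u * v) = u • toVerma l v := rfl

lemma toVerma_mul_envelopingIncl (l : weightLattice m) (u : UniversalEnvelopingAlgebra ℂ (SL m))
    (y : UniversalEnvelopingAlgebra ℂ (borel m)) :
    toVerma l (u * envelopingIncl m y) = envelopingCharacter l y • toVerma l u := by
  rw [← map_smul, ← sub_eq_zero, ← map_sub, toVerma_eq_zero, Algebra.smul_def, Algebra.commutes,
    ← mul_sub]
  exact Submodule.smul_mem _ u (envelopingIncl_sub_mem_vermaIdeal l y)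

/-- A relation lifts to an element of the defining ideal, which `lowerProjection` kills while
returning the coefficients of the relation. -/
lemma linearIndependent_toVerma (l : weightLattice m) :
    LinearIndependent ℂ fun a => toVerma l (lowerMonomial a) := by
  rw [linearIndependent_iff]
  intro c hc
  have h : Finsupp.linearCombination ℂ (fun a => toVerma l (lowerMonomial a)) c =
      toVerma l (Finsupp.linearCombination ℂ lowerMonomial c) := by
    simp [Finsupp.linearCombination_apply, Finsupp.sum, map_sum]
  rw [h, toVerma_eq_zero] at hc
  have h1 := lowerProjection_eq_zero l hc
  have h2 : ∀ a, lowerProjection l (lowerMonomial a) = Finsupp.single a 1 := by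
    intro a
    have := lowerProjection_mul l a 1
    rwa [map_one, mul_one, map_one] at this
  rw [Finsupp.linearCombination_apply, Finsupp.sum, map_sum] at h1
  simp only [map_smul, h2, Finsupp.smul_single, smul_eq_mul, mul_one] at h1
  rwa [← Finsupp.sum_single c]

lemma span_toVerma (l : weightLattice m) :
    Submodule.span ℂ (Set.range fun a => toVerma l (lowerMonomial a)) = ⊤ := by
  rw [eq_top_iff]
  intro v _
  obtain ⟨u, rfl⟩ : ∃ u, toVerma l u = v := Submodule.Quotient.mk_surjective _ v
  have hu : u ∈ Submodule.span ℂ (Set.range (envelopingBasis m)) := (envelopingBasis m).mem_span u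
  induction hu using Submodule.span_induction with
  | mem u hu =>
    obtain ⟨d, rfl⟩ := hu
    rw [envelopingBasis_apply, toVerma_mul_envelopingIncl]
    exact Submodule.smul_mem _ _ (Submodule.subset_span ⟨_, rfl⟩)
  | zero => simp
  | add a b _ _ ha hb => rw [map_add]; exact add_mem (ha trivial) (hb trivial)
  | smul c a _ ha => rw [map_smul]; exact Submodule.smul_mem _ _ (ha trivial)

/-- The basis of the Verma module made of the monomials in the negative root vectors. -/
def vermaBasis (l : weightLattice m) : Basis (NegRoot m →₀ ℕ) ℂ (Verma l) :=
  Basis.mk (linearIndependent_toVerma l) (span_toVerma l).ge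

lemma vermaBasis_apply (l : weightLattice m) (a : NegRoot m →₀ ℕ) :
    vermaBasis l a = toVerma l (lowerMonomial a) := Basis.mk_apply _ _ _

/-- The sum of negative roots with given multiplicities. -/
def rootSum (c : NegRoot m → ℕ) : weightLattice m := ∑ p, c p • (e p.val.1 - e p.val.2)

lemma ι_mul_wprod (h : cartan m) (w : List (NegRoot m)) :
    ι ℂ (h : SL m) * wprod ℂ lowerUnit w = wprod ℂ lowerUnit w * ι ℂ (h : SL m) +
      ((w.map fun p => (e p.val.1 - e p.val.2 : weightLattice m).val h).sum) •
        wprod ℂ lowerUnit w := by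
  induction w with
  | nil => simp
  | cons p w ih =>
    have hc : ι ℂ (h : SL m) * ι ℂ (lowerUnit p) = ι ℂ (lowerUnit p) * ι ℂ (h : SL m) +
        ((e p.val.1 - e p.val.2 : weightLattice m).val h) • ι ℂ (lowerUnit p) := by
      rw [← map_smul, ← lie_lowerUnit, LieHom.map_lie, LieRing.of_associative_ring_bracket]
      abel
    rw [wprod_cons, ← mul_assoc, hc, add_mul, mul_assoc, ih, mul_add, List.map_cons, List.sum_cons,
      add_smul, smul_mul_assoc, mul_smul_comm, mul_assoc]
    abel

lemma sum_word_roots (h : cartan m) (a : NegRoot m →₀ ℕ) :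
    ((word (Finset.univ : Finset (NegRoot m)).toList a).map
      fun p => (e p.val.1 - e p.val.2 : weightLattice m).val h).sum = (rootSum a).val h := by
  have h1 := prod_map_word (Finset.nodup_toList Finset.univ)
    (fun i : NegRoot m => Finset.mem_toList.2 (Finset.mem_univ i)) a
    (fun p => Multiplicative.ofAdd ((e p.val.1 - e p.val.2 : weightLattice m).val h))
  have h2 := congrArg Multiplicative.toAdd h1
  rw [toAdd_prod] at h2
  simp only [toAdd_pow, toAdd_ofAdd] at h2
  let f : weightLattice m →+ ℂ :=
    { toFun := fun w => w.val h, map_zero' := rfl, map_add' := fun _ _ => rfl }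
  have h3 : (rootSum a).val h = ∑ p, a p • (e p.val.1 - e p.val.2 : weightLattice m).val h := by
    change f (rootSum a) = _
    rw [rootSum, map_sum]
    exact Finset.sum_congr rfl fun p _ => map_nsmul f _ _
  rw [h3, ← h2, toAdd_list_sum, List.map_map]
  rfl

lemma lie_vermaBasis (l : weightLattice m) (h : cartan m) (a : NegRoot m →₀ ℕ) :
    ⁅h, vermaBasis l a⁆ = (l + rootSum a).val h • vermaBasis l a := by
  change ι ℂ (h : SL m) • vermaBasis l a = (l.val h + (rootSum a).val h) • vermaBasis l a
  rw [vermaBasis_apply, ← toVerma_mul, lowerMonomial, ι_mul_wprod, sum_word_roots, map_add, map_smul,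
    add_smul]
  congr 1
  let y : borel m := ⟨h, fun i j hij => h.2 (ne_of_gt hij)⟩
  have hd : diagPart y = h := by
    apply Subtype.ext; apply Subtype.ext
    exact (Matrix.isDiag_iff_diagonal_diag _).1 h.2
  have := toVerma_mul_envelopingIncl l
    (wprod ℂ lowerUnit (word (Finset.univ : Finset (NegRoot m)).toList a)) (ι ℂ y)
  rwa [envelopingIncl_ι, envelopingCharacter_ι, hd] at this

/-- The Cartan subalgebra is diagonal in `vermaBasis`: a nonzero coordinate of a weight vector
forces the two weights to agree at every `h`. -/
lemma mem_vermaWeightSpace (l μ : weightLattice m) (v : Verma l) :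
    v ∈ vermaWeightSpace l μ ↔
      (vermaBasis l).repr v ∈ Finsupp.supported ℂ ℂ {a : NegRoot m →₀ ℕ | rootSum a = μ - l} := by
  have hlie : ∀ h : cartan m, ∀ a, (vermaBasis l).repr ⁅h, v⁆ a =
      (l + rootSum a).val h * (vermaBasis l).repr v a := by
    intro h a
    let f : Verma l →ₗ[ℂ] ℂ := (Finsupp.lapply a).comp (vermaBasis l).repr.toLinearMap
    have hf : f.comp (LieModule.toEnd ℂ (cartan m) (Verma l) h) = (l + rootSum a).val h • f := by
      refine (vermaBasis l).ext fun b => ?_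
      simp only [LinearMap.comp_apply, LieModule.toEnd_apply_apply, LinearMap.smul_apply,
        lie_vermaBasis, map_smul]
      by_cases hb : b = a
      · rw [hb]
      · simp [f, hb]
    exact congrArg (fun g => g v) hf
  change v ∈ LieModule.weightSpace (L := cartan m) (Verma l) μ.val ↔ _
  rw [LieModule.mem_weightSpace, Finsupp.mem_supported']
  constructor
  · intro hv a ha
    by_contra hne
    refine ha ?_
    change rootSum a = μ - l
    rw [eq_sub_iff_add_eq, add_comm]
    apply Subtype.ext
    ext1 h
    have h1 := hlie h a
    rw [hv h, map_smul, Finsupp.smul_apply, smul_eq_mul] at h1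
    exact (mul_right_cancel₀ hne h1).symm
  · intro hv h
    apply (vermaBasis l).repr.injective
    ext1 a
    rw [hlie, map_smul, Finsupp.smul_apply, smul_eq_mul]
    by_cases ha : rootSum a = μ - l
    · rw [ha, add_sub_cancel]
    · rw [hv a ha, mul_zero, mul_zero]

lemma vermaWeightSpace_eq_map (l μ : weightLattice m) :
    vermaWeightSpace l μ =
      (Finsupp.supported ℂ ℂ {a : NegRoot m →₀ ℕ | rootSum a = μ - l}).map
        (vermaBasis l).repr.symm.toLinearMap := by
  ext v
  rw [mem_vermaWeightSpace]
  constructor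
  · intro h
    exact ⟨_, h, (vermaBasis l).repr.symm_apply_apply v⟩
  · rintro ⟨w, hw, rfl⟩
    simpa using hw

lemma card_rootSum_eq (ν : weightLattice m) :
    Nat.card {a : NegRoot m →₀ ℕ | rootSum a = ν} = kostantPartition ν :=
  Nat.card_congr (Finsupp.equivFunOnFinite.subtypeEquiv fun _ => Iff.rfl)

lemma finrank_vermaWeightSpace (l μ : weightLattice m)
    (hfin : {c : NegRoot m → ℕ | rootSum c = μ - l}.Finite) :
    FiniteDimensional ℂ (vermaWeightSpace l μ) ∧
      finrank ℂ (vermaWeightSpace l μ) = kostantPartition (μ - l) := by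
  have hf : Finite {a : NegRoot m →₀ ℕ | rootSum a = μ - l} := by
    have := hfin.to_subtype
    exact Finite.of_equiv {c : NegRoot m → ℕ | rootSum c = μ - l}
      (Finsupp.equivFunOnFinite.subtypeEquiv fun _ => Iff.rfl).symm
  have := Fintype.ofFinite {a : NegRoot m →₀ ℕ | rootSum a = μ - l}
  let E := (LinearEquiv.ofEq _ _ (vermaWeightSpace_eq_map l μ)).trans
    (((vermaBasis l).repr.symm.submoduleMap _).symm.trans
      (Finsupp.supportedEquivFinsupp {a : NegRoot m →₀ ℕ | rootSum a = μ - l}))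
  refine ⟨Module.Finite.equiv E.symm, ?_⟩
  rw [E.finrank_eq, Module.finrank_finsupp_self, ← card_rootSum_eq, Nat.card_eq_fintype_card]

/-! ### Integer coordinates for weights, and finiteness by height -/

/-- The weight with given coefficients on the `eᵢ`. -/
def toWeight : (Fin m → ℤ) →+ weightLattice m where
  toFun β := ∑ i, β i • e i
  map_zero' := by simp
  map_add' β γ := by simp [add_smul, Finset.sum_add_distrib]

lemma toWeight_single (i : Fin m) : toWeight (Pi.single i 1) = e i := by
  change ∑ j, (Pi.single i 1 : Fin m → ℤ) j • e j = e i
  rw [Finset.sum_eq_single i]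
  · simp
  · intro j _ hj; simp [hj]
  · simp

lemma toWeight_apply_coroot (β : Fin m → ℤ) (i j : Fin m) :
    (toWeight β).val (coroot i j) = β i - β j := by
  let f : weightLattice m →+ ℂ :=
    { toFun := fun w => w.val (coroot i j), map_zero' := rfl, map_add' := fun _ _ => rfl }
  have he : ∀ k, f (e k) = (if i = k then 1 else 0) - (if j = k then 1 else 0) := by
    intro k
    change (Matrix.single i i 1 - Matrix.single j j 1 : Matrix (Fin m) (Fin m) ℂ) k k = _
    simp [Matrix.sub_apply, Matrix.single_apply]
  change f (∑ k, β k • e k) = _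
  simp only [map_sum, map_zsmul, he]
  simp [mul_sub]

/-- The values on coroots determine `β` up to a constant vector, and the coordinate sum fixes the
constant. -/
lemma toWeight_injOn {β γ : Fin m → ℤ} (hs : ∑ i, β i = ∑ i, γ i) (h : toWeight β = toWeight γ) :
    β = γ := by
  have hd : ∀ i j, β i - γ i = β j - γ j := by
    intro i j
    have h1 := toWeight_apply_coroot β i j
    rw [h, toWeight_apply_coroot] at h1
    have h2 : γ i - γ j = β i - β j := by exact_mod_cast h1
    linarith
  funext i
  have h1 : ∑ j, (β j - γ j) = 0 := by rw [Finset.sum_sub_distrib, hs, sub_self]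
  rw [Finset.sum_congr rfl fun j _ => hd j i] at h1
  have hm : (m : ℤ) ≠ 0 := by have := i.pos; omega
  simp only [Finset.sum_const, Finset.card_univ, Fintype.card_fin, nsmul_eq_mul] at h1
  have := (mul_eq_zero.1 h1).resolve_left hm
  linarith

/-- The coordinate vector of a negative root. -/
def rootVector (p : NegRoot m) : Fin m → ℤ := Pi.single p.val.1 1 - Pi.single p.val.2 1

lemma sum_rootVector (p : NegRoot m) : ∑ i, rootVector p i = 0 := by
  simp [rootVector, Finset.sum_sub_distrib]

lemma sum_sum_rootVector (c : NegRoot m → ℕ) : ∑ i, (∑ p, (c p : ℤ) • rootVector p) i = 0 := by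
  simp only [Finset.sum_apply, Pi.smul_apply, smul_eq_mul]
  rw [Finset.sum_comm]
  simp [← Finset.mul_sum, sum_rootVector]

lemma toWeight_rootVector (c : NegRoot m → ℕ) :
    toWeight (∑ p, (c p : ℤ) • rootVector p) = rootSum c := by
  rw [map_sum, rootSum]
  refine Finset.sum_congr rfl fun p _ => ?_
  rw [map_zsmul, rootVector, map_sub, toWeight_single, toWeight_single, natCast_zsmul]

lemma rootSum_eq_iff {β : Fin m → ℤ} (hβ : ∑ i, β i = 0) (c : NegRoot m → ℕ) :
    rootSum c = toWeight β ↔ ∑ p, (c p : ℤ) • rootVector p = β := by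
  rw [← toWeight_rootVector]
  exact ⟨toWeight_injOn ((sum_sum_rootVector c).trans hβ.symm), fun h => congrArg _ h⟩

/-- The height of a vector, which is positive on the negative roots. -/
def height (β : Fin m → ℤ) : ℤ := ∑ i : Fin m, ((i : ℕ) : ℤ) * β i

/-- Every negative root has height at least `1`, so the height of a combination dominates each
coefficient. -/
lemma le_height (c : NegRoot m → ℕ) (p : NegRoot m) :
    (c p : ℤ) ≤ height (∑ p, (c p : ℤ) • rootVector p) := by
  have h : height (∑ p, (c p : ℤ) • rootVector p) =
      ∑ p, (c p : ℤ) * (((p.val.1 : ℕ) : ℤ) - ((p.val.2 : ℕ) : ℤ)) := by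
    simp only [height, Finset.sum_apply, Pi.smul_apply, smul_eq_mul, Finset.mul_sum]
    rw [Finset.sum_comm]
    refine Finset.sum_congr rfl fun q _ => ?_
    have : ∀ i : Fin m, ((i : ℕ) : ℤ) * ((c q : ℤ) * rootVector q i) =
        (c q : ℤ) * ((if i = q.val.1 then ((i : ℕ) : ℤ) else 0) - (if i = q.val.2 then ((i : ℕ) : ℤ) else 0)) := by
      intro i
      simp only [rootVector, Pi.sub_apply, Pi.single_apply]
      split_ifs <;> ring
    rw [Finset.sum_congr rfl fun i _ => this i, ← Finset.mul_sum, Finset.sum_sub_distrib]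
    simp
  have hpos : ∀ q : NegRoot m, (1 : ℤ) ≤ ((q.val.1 : ℕ) : ℤ) - ((q.val.2 : ℕ) : ℤ) := by
    intro q
    have := q.2
    omega
  rw [h]
  calc (c p : ℤ) ≤ (c p : ℤ) * (((p.val.1 : ℕ) : ℤ) - ((p.val.2 : ℕ) : ℤ)) :=
        le_mul_of_one_le_right (by positivity) (hpos p)
    _ ≤ _ := Finset.single_le_sum (f := fun q : NegRoot m => (c q : ℤ) * (((q.val.1 : ℕ) : ℤ) - ((q.val.2 : ℕ) : ℤ)))
        (fun q _ => mul_nonneg (by positivity) (by have := hpos q; omega)) (Finset.mem_univ p)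

lemma finite_rootSum_eq (ν : weightLattice m) : {c : NegRoot m → ℕ | rootSum c = ν}.Finite := by
  rcases Set.eq_empty_or_nonempty {c : NegRoot m → ℕ | rootSum c = ν} with h | ⟨c₀, rfl⟩
  · rw [h]; exact Set.finite_empty
  · refine (Set.finite_Iic (fun _ : NegRoot m =>
      (height (∑ p, (c₀ p : ℤ) • rootVector p)).toNat)).subset ?_
    intro c hc p
    rw [Set.mem_ofPred_eq, ← toWeight_rootVector c₀, rootSum_eq_iff (sum_sum_rootVector c₀)] at hc
    have := le_height c p
    rw [hc] at this
    dsimp only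
    omega

end VermaSl

end

/-! ### Lorentzian functions and counting bounded combinations -/

noncomputable section

namespace LorentzianCount

/-- The quadratic form with the matrix `(a, b, y; b, d, y'; y, y', z)` is nonpositive on the orthogonal
complement of the first basis vector. -/
def Hyperbolic₃ (a b d y y' z : ℝ) : Prop :=
  ∀ s t r, a * s + b * t + y * r = 0 →
    a * s ^ 2 + 2 * b * s * t + d * t ^ 2 + 2 * y * s * r + 2 * y' * t * r + z * r ^ 2 ≤ 0

lemma Hyperbolic₃.mono {a b d d' y y' z : ℝ} (h : Hyperbolic₃ a b d y y' z) (hd : d' ≤ d) :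
    Hyperbolic₃ a b d' y y' z := by
  intro s t r h0
  have h1 := h s t r h0
  have h2 := mul_le_mul_of_nonneg_right hd (sq_nonneg t)
  linarith

lemma Hyperbolic₃.mul_le_sq {a b d y y' z : ℝ} (h : Hyperbolic₃ a b d y y' z) (ha : 0 < a) :
    a * d ≤ b ^ 2 := by
  have h1 := h (-b) a 0 (by ring)
  have h2 : a * (a * d - b ^ 2) ≤ 0 := by linarith
  have h3 := nonpos_of_mul_nonpos_right h2 ha
  linarith

/-- The first row of the second form is the second row of the sum. Hence a vector orthogonal to the
first two basis vectors for the sum is orthogonal to the first one for each summand, and both forms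
are nonpositive there. The remaining direction is negative by `hD`. -/
lemma Hyperbolic₃.add {a a' y y' z S S' Y Y' Z d₁ d₂ : ℝ} (h₁ : Hyperbolic₃ a a' d₁ y y' z)
    (h₂ : Hyperbolic₃ S S' d₂ Y Y' Z) (hd : d₁ + d₂ = S') (ha : 0 < a) (hS : 0 < S)
    (hS' : a' + S' = S) (hY' : y' + Y' = Y) (hD : (a + S) * S' < S ^ 2) :
    Hyperbolic₃ (a + S) S S' (y + Y) Y (z + Z) := by
  intro s t r h0
  have hT : 0 < a + S := by linarith
  -- The direction `(u, -1, 0)` is orthogonal to the first basis vector and has value `S' - u * S`;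
  -- `v` is the multiple of it that makes the given vector orthogonal to the second one too.
  obtain ⟨u, hu⟩ : ∃ u, u * (a + S) = S := ⟨S / (a + S), div_mul_cancel₀ _ hT.ne'⟩
  have hw : S' - u * S < 0 := by
    have : (a + S) * (S' - u * S) < 0 := by
      have e : (a + S) * (S' - u * S) = (a + S) * S' - S ^ 2 := by linear_combination -S * hu
      linarith
    exact neg_of_mul_neg_right this hT.le
  obtain ⟨v, hv⟩ : ∃ v, v * (S' - u * S) = S * s + S' * t + Y * r :=
    ⟨_, div_mul_cancel₀ _ hw.ne⟩
  have c₁ : (a + S) * (s + v * u) + S * (t - v) + (y + Y) * r = 0 := by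
    linear_combination h0 + v * hu
  have c₂ : S * (s + v * u) + S' * (t - v) + Y * r = 0 := by
    linear_combination -hv
  have f₂ := h₂ _ _ _ c₂
  have f₁ := h₁ (s + v * u) (t - v) r (by
    linear_combination c₁ - c₂ + (t - v) * hS')
  have f₃ : v ^ 2 * (S' - u * S) ≤ 0 := mul_nonpos_of_nonneg_of_nonpos (sq_nonneg v) hw.le
  have e : (a + S) * s ^ 2 + 2 * S * s * t + S' * t ^ 2 + 2 * (y + Y) * s * r + 2 * Y * t * r +
      (z + Z) * r ^ 2 =
      (a * (s + v * u) ^ 2 + 2 * a' * (s + v * u) * (t - v) + d₁ * (t - v) ^ 2 +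
        2 * y * (s + v * u) * r + 2 * y' * (t - v) * r + z * r ^ 2) +
      (S * (s + v * u) ^ 2 + 2 * S' * (s + v * u) * (t - v) + d₂ * (t - v) ^ 2 +
        2 * Y * (s + v * u) * r + 2 * Y' * (t - v) * r + Z * r ^ 2) + v ^ 2 * (S' - u * S) := by
    linear_combination 2 * v * (c₂ - u * c₁) + v ^ 2 * u * hu - 2 * (s + v * u) * (t - v) * hS' -
      (t - v) ^ 2 * hd - 2 * (t - v) * r * hY'
  linarith

/-- Log-concavity bounds `a 0 * a (k + 2)` by `a 1 * a (k + 1)`; the extra term on the right makes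
the inequality strict. This is the negativity condition `hD` of `Hyperbolic₃.add`. -/
lemma mul_sum_lt (n : ℕ) (a : ℕ → ℝ) (ha : ∀ k, 0 < a k)
    (h : ∀ k, a k * a (k + 2) ≤ a (k + 1) ^ 2) :
    a 0 * ∑ k ∈ Finset.range n, a (k + 2) < a 1 * ∑ k ∈ Finset.range (n + 1), a (k + 1) := by
  induction n generalizing a with
  | zero => simpa using mul_pos (ha 1) (ha 1)
  | succ n ih =>
    have h1 := ih (fun k => a (k + 1)) (fun k => ha _) (fun k => h (k + 1))
    rw [Finset.sum_range_succ' (fun k => a (k + 2)), Finset.sum_range_succ' (fun k => a (k + 1))]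
    simp only [zero_add, add_assoc, Nat.reduceAdd] at h1 ⊢
    rw [Finset.sum_range_succ' (fun k => a (k + 2))] at *
    simp only [zero_add, add_assoc, Nat.reduceAdd] at h1 ⊢
    have h0 := h 0
    simp only [zero_add] at h0
    set T := ∑ k ∈ Finset.range n, a (k + 3)
    have h2 : a 1 * (a 0 * T) < a 1 * (a 1 * (T + a 2)) := by
      have i1 := mul_lt_mul_of_pos_left h1 (ha 0)
      have hT : 0 ≤ T + a 2 :=
        add_nonneg (Finset.sum_nonneg fun k _ => (ha _).le) (ha _).le
      have i2 := mul_le_mul_of_nonneg_right h0 hT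
      nlinarith
    have h3 := lt_of_mul_lt_mul_left h2 (ha 1).le
    nlinarith

/-- The shorter ranges treat `a` and `y` as zero beyond index `n`. The second row of the total is
then the first row of the total for the shifted sequences, so `Hyperbolic₃.add` applies inductively.
-/
lemma Hyperbolic₃.sum (n : ℕ) (a y z : ℕ → ℝ) (ha : ∀ k, 0 < a k)
    (h : ∀ k, Hyperbolic₃ (a k) (a (k + 1)) (a (k + 2)) (y k) (y (k + 1)) (z k)) :
    Hyperbolic₃ (∑ k ∈ Finset.range (n + 1), a k) (∑ k ∈ Finset.range n, a (k + 1))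
      (∑ k ∈ Finset.range (n - 1), a (k + 2)) (∑ k ∈ Finset.range (n + 1), y k)
      (∑ k ∈ Finset.range n, y (k + 1)) (∑ k ∈ Finset.range (n + 1), z k) := by
  induction n generalizing a y z with
  | zero =>
    intro s t r h0
    have := h 0 s 0 r (by simpa using h0)
    simpa using this
  | succ n ih =>
    have h1 := ih (fun k => a (k + 1)) (fun k => y (k + 1)) (fun k => z (k + 1)) (fun k => ha _)
      (fun k => h _)
    rw [Finset.sum_range_succ' a, Finset.sum_range_succ' y, Finset.sum_range_succ' z, add_comm,
      add_comm _ (y 0), add_comm _ (z 0), Nat.add_sub_cancel]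
    simp only [add_assoc, Nat.reduceAdd] at h1
    have hlc := mul_sum_lt n a ha fun k => (h k).mul_le_sq (ha k)
    have e1 : ∀ f : ℕ → ℝ, f 1 + ∑ k ∈ Finset.range n, f (k + 2) =
        ∑ k ∈ Finset.range (n + 1), f (k + 1) := fun f => by
      rw [Finset.sum_range_succ' (fun k => f (k + 1)), add_comm]
    have hD : (a 0 + ∑ k ∈ Finset.range (n + 1), a (k + 1)) * ∑ k ∈ Finset.range n, a (k + 2) <
        (∑ k ∈ Finset.range (n + 1), a (k + 1)) ^ 2 := by
      have := e1 a
      set S := ∑ k ∈ Finset.range (n + 1), a (k + 1)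
      set S' := ∑ k ∈ Finset.range n, a (k + 2)
      have hS' : S' = S - a 1 := by linarith
      calc _ = a 0 * S' + S * S' := by ring
        _ < a 1 * S + S * S' := by linarith
        _ = S ^ 2 := by rw [hS']; ring
    have hS : 0 < ∑ k ∈ Finset.range (n + 1), a (k + 1) :=
      Finset.sum_pos (fun k _ => ha _) (by simp)
    obtain _ | n := n
    -- With only two terms the truncated corner entry is `0`, so `a 2` is first lowered to `0`.
    · exact ((h 0).mono (d' := 0) (ha 2).le).add h1 (by simp) (ha 0) hS (e1 a) (e1 y) hD
    · refine (h 0).add h1 ?_ (ha 0) hS (e1 a) (e1 y) hD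
      rw [Nat.add_sub_cancel, Finset.sum_range_succ' (fun k => a (k + 2)), add_comm]

variable {ι : Type*} [Fintype ι] [DecidableEq ι]

/-- The unit vector of an index. -/
abbrev unit (i : ι) : ι → ℤ := Pi.single i 1

/-- The linear form of the `i`-th row of the matrix `c (α + eᵢ + eⱼ)`. -/
def row (c : (ι → ℤ) → ℝ) (α : ι → ℤ) (i : ι) (x : ι → ℝ) : ℝ :=
  ∑ j, x j * c (α + unit i + unit j)

/-- The quadratic form with the matrix `c (α + eᵢ + eⱼ)`. -/
def quad (c : (ι → ℤ) → ℝ) (α : ι → ℤ) (x : ι → ℝ) : ℝ := ∑ i, x i * row c α i x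

/-- Positive functions on a lattice whose matrices `c (α + eᵢ + eⱼ)` satisfy the reverse Cauchy-Schwarz
inequality, that is, have exactly one positive eigenvalue. -/
structure IsLorentzian (c : (ι → ℤ) → ℝ) : Prop where
  pos : ∀ β, 0 < c β
  reverse_cauchy : ∀ α i x, quad c α x * c (α + unit i + unit i) ≤ row c α i x ^ 2

lemma row_add_smul (c : (ι → ℤ) → ℝ) (α : ι → ℤ) (i j : ι) (t : ℝ) (x : ι → ℝ) :
    row c α i (x + t • Pi.single j 1) = row c α i x + t * c (α + unit i + unit j) := by
  simp only [row, Pi.add_apply, Pi.smul_apply, add_mul, Finset.sum_add_distrib, smul_eq_mul]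
  congr 1
  rw [Finset.sum_eq_single j]
  · simp
  · intro k _ hk; simp [hk]
  · simp

lemma row_smul (c : (ι → ℤ) → ℝ) (α : ι → ℤ) (i : ι) (r : ℝ) (x : ι → ℝ) :
    row c α i (r • x) = r * row c α i x := by
  simp [row, Finset.mul_sum, mul_assoc]

lemma quad_smul (c : (ι → ℤ) → ℝ) (α : ι → ℤ) (r : ℝ) (x : ι → ℝ) :
    quad c α (r • x) = r ^ 2 * quad c α x := by
  simp only [quad, row_smul, Finset.mul_sum, Pi.smul_apply, smul_eq_mul]
  exact Finset.sum_congr rfl fun i _ => by ring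

lemma quad_add_smul (c : (ι → ℤ) → ℝ) (α : ι → ℤ) (j : ι) (t : ℝ) (x : ι → ℝ) :
    quad c α (x + t • Pi.single j 1) =
      quad c α x + 2 * t * row c α j x + t ^ 2 * c (α + unit j + unit j) := by
  have h1 : ∀ f : ι → ℝ, ∑ i, (x + t • (Pi.single j 1 : ι → ℝ)) i * f i = ∑ i, x i * f i + t * f j := by
    intro f
    simp only [Pi.add_apply, Pi.smul_apply, add_mul, Finset.sum_add_distrib, smul_eq_mul]
    congr 1
    rw [Finset.sum_eq_single j]
    · simp
    · intro k _ hk; simp [hk]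
    · simp
  have h2 : ∑ i, x i * c (α + unit i + unit j) = row c α j x :=
    Finset.sum_congr rfl fun i _ => by rw [add_right_comm]
  rw [quad, h1]
  simp only [row_add_smul, mul_add, Finset.sum_add_distrib]
  have h3 : ∑ i, x i * (t * c (α + unit i + unit j)) = t * row c α j x := by
    rw [← h2, Finset.mul_sum]
    exact Finset.sum_congr rfl fun i _ => by ring
  rw [h3, ← quad]
  ring

/-- The `3 × 3` matrix is the Gram matrix of `eᵢ`, `eⱼ`, `x`; reverse Cauchy–Schwarz for a
combination orthogonal to `eᵢ` has right side `0`. -/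
lemma hyperbolic₃_of_reverse_cauchy {c : (ι → ℤ) → ℝ} (hc : ∀ β, 0 < c β) {α : ι → ℤ} {i : ι}
    (h : ∀ x, quad c α x * c (α + unit i + unit i) ≤ row c α i x ^ 2) (j : ι) (x : ι → ℝ) :
    Hyperbolic₃ (c (α + unit i + unit i)) (c (α + unit i + unit j)) (c (α + unit j + unit j))
      (row c α i x) (row c α j x) (quad c α x) := by
  intro s t r h0
  have h1 := h (r • x + s • Pi.single i 1 + t • Pi.single j 1)
  simp only [row_add_smul, quad_add_smul, row_smul, quad_smul] at h1
  rw [add_right_comm α (unit j) (unit i)] at h1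
  have e : r * row c α i x + s * c (α + unit i + unit i) + t * c (α + unit i + unit j) = 0 := by
    linear_combination h0
  rw [e, zero_pow two_ne_zero] at h1
  have h2 := nonpos_of_mul_nonpos_left h1 (hc _)
  linarith

/-- Having one positive direction does not depend on which `eᵢ` witnesses it: `x + t eⱼ` is made
orthogonal to `eᵢ`, and completing the square in `t` gives the inequality for `eⱼ`. -/
lemma isLorentzian_of_index {c : (ι → ℤ) → ℝ} (hc : ∀ β, 0 < c β) (i : ι)
    (h : ∀ α x, quad c α x * c (α + unit i + unit i) ≤ row c α i x ^ 2) : IsLorentzian c where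
  pos := hc
  reverse_cauchy α j x := by
    have hb := hc (α + unit i + unit j)
    obtain ⟨t, ht⟩ : ∃ t, t * c (α + unit i + unit j) = -row c α i x :=
      ⟨_, div_mul_cancel₀ _ hb.ne'⟩
    have h1 := hyperbolic₃_of_reverse_cauchy hc (h α) j x 0 t 1 (by linear_combination ht)
    have h2 := mul_le_mul_of_nonneg_right h1 (hc (α + unit j + unit j)).le
    have h3 := sq_nonneg (t * c (α + unit j + unit j) + row c α j x)
    nlinarith

/-- The sum of the first translates of a Lorentzian function in the direction of a root is Lorentzian. -/
lemma IsLorentzian.sum_translates {c : (ι → ℤ) → ℝ} (hc : IsLorentzian c) (i j : ι) (K : ℕ) :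
    IsLorentzian fun β => ∑ k ∈ Finset.range (K + 1), c (β - (k : ℤ) • (unit i - unit j)) := by
  refine isLorentzian_of_index (i := i)
    (fun β => Finset.sum_pos (fun k _ => hc.pos _) (by simp)) fun α x => ?_
  let A : ℕ → ι → ℤ := fun k => α - (k : ℤ) • (unit i - unit j)
  -- Because of this, the `eⱼ` entries at one translate are the `eᵢ` entries at the next, which is
  -- the shift pattern of `Hyperbolic₃.sum`.
  have hA : ∀ k, A k + unit j = A (k + 1) + unit i := by
    intro k
    simp only [A]
    push_cast
    rw [add_smul, one_smul]
    abel
  have hrow : ∀ l y, row (fun β => ∑ k ∈ Finset.range (K + 1), c (β - (k : ℤ) • (unit i - unit j)))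
      α l y = ∑ k ∈ Finset.range (K + 1), row c (A k) l y := by
    intro l y
    simp only [row, Finset.mul_sum]
    rw [Finset.sum_comm]
    refine Finset.sum_congr rfl fun k _ => Finset.sum_congr rfl fun p _ => ?_
    congr 2
    simp only [A]
    abel
  have hquad : quad (fun β => ∑ k ∈ Finset.range (K + 1), c (β - (k : ℤ) • (unit i - unit j)))
      α x = ∑ k ∈ Finset.range (K + 1), quad c (A k) x := by
    simp only [quad, hrow, Finset.mul_sum]
    rw [Finset.sum_comm]
  have hcc : ∑ k ∈ Finset.range (K + 1), c (α + unit i + unit i - (k : ℤ) • (unit i - unit j)) =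
      ∑ k ∈ Finset.range (K + 1), c (A k + unit i + unit i) := by
    refine Finset.sum_congr rfl fun k _ => ?_
    congr 1
    simp only [A]
    abel
  have key := Hyperbolic₃.sum K (fun k => c (A k + unit i + unit i)) (fun k => row c (A k) i x)
    (fun k => quad c (A k) x) (fun k => hc.pos _) (fun k => by
      have h := hyperbolic₃_of_reverse_cauchy hc.pos (hc.reverse_cauchy (A k) i) j x
      have e1 : A k + unit i + unit j = A (k + 1) + unit i + unit i := by
        rw [add_right_comm, hA]
      have e2 : A k + unit j + unit j = A (k + 2) + unit i + unit i := by
        rw [hA, add_right_comm, hA, add_right_comm]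
      have e3 : row c (A k) j x = row c (A (k + 1)) i x := by
        simp only [row, hA]
      rwa [e1, e2, e3] at h)
  rw [hquad, hrow]
  rw [hcc]
  set S := ∑ k ∈ Finset.range (K + 1), c (A k + unit i + unit i)
  have hS : 0 < S := Finset.sum_pos (fun k _ => hc.pos _) (by simp)
  set Y := ∑ k ∈ Finset.range (K + 1), row c (A k) i x
  -- The vector `S x - Y eᵢ` is orthogonal to `eᵢ`; since its `eⱼ` coefficient is `0`, the truncated
  -- entries play no role.
  have h1 := key (-Y) 0 S (by ring)
  have h2 : S * (S * (∑ k ∈ Finset.range (K + 1), quad c (A k) x) - Y ^ 2) ≤ 0 := by linarith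
  have h3 := nonpos_of_mul_nonpos_right h2 hS
  linarith

/-- The discrete Gaussian. -/
def gauss (q : ℝ) (β : ι → ℤ) : ℝ := q ^ (∑ i, β i ^ 2).toNat

/-- Up to a positive factor and a diagonal rescaling, the matrix is the all-ones matrix minus `1 -
q²` times the identity. -/
lemma isLorentzian_gauss {q : ℝ} (hq : 0 < q) (hq1 : q < 1) :
    IsLorentzian (gauss q : (ι → ℤ) → ℝ) := by
  have hz : ∀ β : ι → ℤ, gauss q β = q ^ (∑ i, β i ^ 2 : ℤ) := by
    intro β
    rw [gauss, ← zpow_natCast, Int.toNat_of_nonneg (Finset.sum_nonneg fun i _ => sq_nonneg _)]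
  have hent : ∀ (α : ι → ℤ) (i j : ι), gauss q (α + unit i + unit j) =
      q ^ (∑ i, α i ^ 2 + 2 : ℤ) * q ^ (2 * α i) * q ^ (2 * α j) * (if i = j then q ^ 2 else 1) := by
    intro α i j
    have e : ∑ k, (α + unit i + unit j) k ^ 2 =
        (∑ k, α k ^ 2 + 2) + 2 * α i + 2 * α j + (if i = j then 2 else 0) := by
      have : ∀ k, (α + unit i + unit j) k ^ 2 = α k ^ 2 + (if k = i then 2 * α k + 1 else 0) +
          (if k = j then 2 * α k + 1 else 0) + (if k = i then (if k = j then 2 else 0) else 0) := by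
        intro k
        simp only [Pi.add_apply, unit, Pi.single_apply]
        split_ifs <;> ring
      simp only [this, Finset.sum_add_distrib, Finset.sum_ite_eq', Finset.mem_univ, if_true]
      ring
    rw [hz, e, zpow_add₀ hq.ne', zpow_add₀ hq.ne', zpow_add₀ hq.ne']
    split_ifs <;> simp
  refine ⟨fun β => by rw [hz]; positivity, fun α i x => ?_⟩
  set C := q ^ (∑ i, α i ^ 2 + 2 : ℤ)
  have hC : 0 < C := by positivity
  set w : ι → ℝ := fun j => q ^ (2 * α j) * x j
  have hrow : ∀ i, row (gauss q) α i x =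
      C * q ^ (2 * α i) * (∑ j, w j - (1 - q ^ 2) * w i) := by
    intro i
    have : ∀ j, x j * gauss q (α + unit i + unit j) =
        C * q ^ (2 * α i) * (w j - if i = j then (1 - q ^ 2) * w j else 0) := by
      intro j
      rw [hent]
      split_ifs <;> simp only [w] <;> ring
    simp only [row, this, ← Finset.mul_sum, Finset.sum_sub_distrib, Finset.sum_ite_eq,
      Finset.mem_univ, if_true]
  have hquad : quad (gauss q) α x = C * ((∑ j, w j) ^ 2 - (1 - q ^ 2) * ∑ j, w j ^ 2) := by
    have : ∀ i, x i * row (gauss q) α i x =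
        C * (w i * (∑ j, w j) - (1 - q ^ 2) * w i ^ 2) := by
      intro i
      rw [hrow]
      have : C * q ^ (2 * α i) * (∑ j, w j - (1 - q ^ 2) * w i) * x i =
        C * (q ^ (2 * α i) * x i) * (∑ j, w j - (1 - q ^ 2) * w i) := by ring
      rw [mul_comm, this]
      change C * w i * _ = _
      ring
    simp only [quad, this, ← Finset.mul_sum, Finset.sum_sub_distrib, ← Finset.sum_mul]
    ring
  rw [hquad, hrow, hent, if_pos rfl]
  set T := ∑ j, w j
  have hw : w i ^ 2 ≤ ∑ j, w j ^ 2 :=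
    Finset.single_le_sum (f := fun j => w j ^ 2) (fun j _ => sq_nonneg _) (Finset.mem_univ i)
  have hε : 0 < 1 - q ^ 2 := by nlinarith
  have h1 : q ^ 2 * (T ^ 2 - (1 - q ^ 2) * ∑ j, w j ^ 2) ≤ (T - (1 - q ^ 2) * w i) ^ 2 := by
    -- Once only `w i` is kept in the sum, the two sides differ by `(1 - q²)(T - w i)²`.
    have i1 : q ^ 2 * (T ^ 2 - (1 - q ^ 2) * ∑ j, w j ^ 2) ≤
        q ^ 2 * (T ^ 2 - (1 - q ^ 2) * w i ^ 2) := by gcongr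
    have i2 := mul_nonneg hε.le (sq_nonneg (T - w i))
    nlinarith
  have h2 := mul_le_mul_of_nonneg_left h1 (sq_nonneg (C * q ^ (2 * α i)))
  calc _ = (C * q ^ (2 * α i)) ^ 2 * (q ^ 2 * (T ^ 2 - (1 - q ^ 2) * ∑ j, w j ^ 2)) := by ring
    _ ≤ _ := h2
    _ = _ := by ring

lemma IsLorentzian.sum_combinations {c : (ι → ℤ) → ℝ} (hc : IsLorentzian c) (K : ℕ) {r : ℕ}
    (a b : Fin r → ι) :
    IsLorentzian fun β => ∑ f : Fin r → Fin (K + 1),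
      c (β - ∑ p, ((f p : ℕ) : ℤ) • (unit (a p) - unit (b p))) := by
  induction r with
  | zero => simpa using hc
  | succ r ih =>
    have h := (ih (fun p => a p.succ) (fun p => b p.succ)).sum_translates (a 0) (b 0) K
    convert h using 2 with β
    rw [Finset.sum_range, ← (Fin.consEquiv fun _ => Fin (K + 1)).sum_comp, Fintype.sum_prod_type]
    refine Finset.sum_congr rfl fun k _ => Finset.sum_congr rfl fun f _ => ?_
    congr 1
    rw [Fin.sum_univ_succ]
    simp [sub_sub]

/-- The number of representations of a vector as a combination of roots with bounded coefficients is
log-concave in root directions. -/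
theorem card_combinations_log_concave {τ : Type*} [Fintype τ] [DecidableEq τ] (a b : τ → ι) (K : ℕ)
    (α : ι → ℤ) (i j : ι) :
    let N : (ι → ℤ) → ℕ := fun β => Fintype.card
      {f : τ → Fin (K + 1) // ∑ p, ((f p : ℕ) : ℤ) • (unit (a p) - unit (b p)) = β}
    N (α + unit i + unit i) * N (α + unit j + unit j) ≤ N (α + unit i + unit j) ^ 2 := by
  intro N
  let ε := Fintype.equivFin τ
  let c : ℝ → (ι → ℤ) → ℝ := fun q β => ∑ f : τ → Fin (K + 1),
      gauss q (β - ∑ p, ((f p : ℕ) : ℤ) • (unit (a p) - unit (b p)))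
  have hL : ∀ q, 0 < q → q < 1 → IsLorentzian (c q) := by
    intro q hq hq1
    convert (isLorentzian_gauss (ι := ι) hq hq1).sum_combinations K (a ∘ ε.symm) (b ∘ ε.symm)
      using 2 with β
    rw [← (Equiv.arrowCongr ε (Equiv.refl (Fin (K + 1)))).sum_comp]
    refine Finset.sum_congr rfl fun f _ => ?_
    congr 2
    rw [← ε.symm.sum_comp]
    rfl
  have hineq : ∀ q, 0 < q → q < 1 →
      c q (α + unit i + unit i) * c q (α + unit j + unit j) ≤ c q (α + unit i + unit j) ^ 2 := by
    intro q hq hq1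
    have h := hyperbolic₃_of_reverse_cauchy (hL q hq hq1).pos ((hL q hq hq1).reverse_cauchy α i) j 0
    exact h.mul_le_sq ((hL q hq hq1).pos _)
  have hcont : ∀ β, Continuous fun q => c q β := by
    intro β
    unfold c gauss
    fun_prop
  have h0 : c 0 (α + unit i + unit i) * c 0 (α + unit j + unit j) ≤
      c 0 (α + unit i + unit j) ^ 2 := by
    have hl := ((hcont (α + unit i + unit i)).mul (hcont (α + unit j + unit j))).tendsto 0
    have hr := ((hcont (α + unit i + unit j)).pow 2).tendsto 0
    refine le_of_tendsto_of_tendsto (hl.mono_left (nhdsWithin_le_nhds (s := Set.Ioi 0)))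
      (hr.mono_left nhdsWithin_le_nhds) ?_
    filter_upwards [Ioo_mem_nhdsGT (show (0 : ℝ) < 1 by norm_num)] with q hq
    exact hineq q hq.1 hq.2
  have hN : ∀ β, c 0 β = N β := by
    intro β
    -- As `0 ^ 0 = 1`, the Gaussian at `q = 0` is the indicator of `0`. It is not positive, hence
    -- the limit from `q > 0`.
    have hg : ∀ γ : ι → ℤ, gauss 0 γ = if γ = 0 then 1 else 0 := by
      intro γ
      rw [gauss, zero_pow_eq]
      congr 1
      rw [Int.toNat_eq_zero, eq_iff_iff]
      constructor
      · intro h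
        have h1 := le_antisymm h (Finset.sum_nonneg fun i _ => sq_nonneg _)
        rw [Finset.sum_eq_zero_iff_of_nonneg fun i _ => sq_nonneg _] at h1
        funext i
        simpa using h1 i (Finset.mem_univ i)
      · rintro rfl; simp
    simp only [c, hg, sub_eq_zero, N]
    rw [Finset.sum_boole, Fintype.card_subtype]
    simp only [eq_comm]
  rw [hN, hN, hN] at h0
  exact_mod_cast h0

end LorentzianCount

end

/-! ### Log-concavity of the Kostant partition function -/

noncomputable section

namespace VermaSl

open LorentzianCount

variable {m : ℕ}

/-- The height bound makes the cap `K` on the coefficients vacuous. -/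
lemma kostantPartition_toWeight {β : Fin m → ℤ} (hβ : ∑ i, β i = 0) {K : ℕ} (hK : height β ≤ K) :
    kostantPartition (toWeight β) = Fintype.card {f : NegRoot m → Fin (K + 1) //
      ∑ p, ((f p : ℕ) : ℤ) • (unit p.val.1 - unit p.val.2) = β} := by
  have hle : ∀ c : NegRoot m → ℕ, rootSum c = toWeight β → ∀ p, c p < K + 1 := by
    intro c hc p
    rw [rootSum_eq_iff hβ] at hc
    have := le_height c p
    rw [hc] at this
    omega
  rw [← Nat.card_eq_fintype_card, kostantPartition]
  exact Nat.card_congr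
    { toFun := fun c => ⟨fun p => ⟨c.val p, hle c.val c.2 p⟩, (rootSum_eq_iff hβ c.val).1 c.2⟩
      invFun := fun f => ⟨fun p => f.val p, (rootSum_eq_iff hβ fun p => f.val p).2 f.2⟩
      left_inv := fun _ => rfl
      right_inv := fun _ => rfl }

/-- The Kostant partition function is log-concave in root directions. -/
theorem kostantPartition_log_concave (ν : weightLattice m) (i j : Fin m) :
    kostantPartition (ν + e i - e j) * kostantPartition (ν + e j - e i) ≤
      kostantPartition ν ^ 2 := by
  by_cases h0 : kostantPartition (ν + e i - e j) = 0
  · rw [h0, zero_mul]; exact Nat.zero_le _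
  -- A nonzero count provides a representation, hence integer coordinates `γ` of sum `0` for the
  -- weight.
  obtain ⟨⟨c, hc⟩⟩ := (Nat.card_pos_iff.1 (Nat.pos_of_ne_zero h0)).1
  have hc' : rootSum c = ν + e i - e j := hc
  set γ := ∑ p, (c p : ℤ) • rootVector p
  have hγ : toWeight γ = ν + e i - e j := (toWeight_rootVector c).trans hc'
  -- With this base point, the entries `(i,i)`, `(i,j)`, `(j,j)` of the matrix at `α` correspond to
  -- `ν + eᵢ - eⱼ`, `ν`, `ν + eⱼ - eᵢ`.
  let α : Fin m → ℤ := γ - unit i - unit i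
  have hu : ∀ k : Fin m, toWeight (unit k) = e k := toWeight_single
  have hs : ∀ k : Fin m, ∑ x, (unit k : Fin m → ℤ) x = 1 := fun k => by simp
  have hγs : ∑ x, γ x = 0 := sum_sum_rootVector c
  have hα : ∀ k l, ∑ x, (α + unit k + unit l : Fin m → ℤ) x = 0 := by
    intro k l
    simp only [α, Pi.add_apply, Pi.sub_apply, Finset.sum_add_distrib, Finset.sum_sub_distrib, hγs, hs]
    norm_num
  have w1 : toWeight (α + unit i + unit i) = ν + e i - e j := by
    rw [← hγ]; congr 1; simp only [α]; abel
  have w2 : toWeight (α + unit i + unit j) = ν := by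
    simp only [α, map_add, map_sub, hγ, hu]; abel
  have w3 : toWeight (α + unit j + unit j) = ν + e j - e i := by
    simp only [α, map_add, map_sub, hγ, hu]; abel
  set K := (height (α + unit i + unit i)).toNat + (height (α + unit i + unit j)).toNat +
    (height (α + unit j + unit j)).toNat
  have key := card_combinations_log_concave (fun p : NegRoot m => p.val.1) (fun p => p.val.2) K α i j
  rw [← w1, ← w3, kostantPartition_toWeight (hα i i) (K := K) (by omega),
    kostantPartition_toWeight (hα j j) (K := K) (by omega)]
  conv_rhs => rw [← w2, kostantPartition_toWeight (hα i j) (K := K) (by omega)]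
  exact key

end VermaSl

end

theorem mainTheorem9 (m : ℕ) (l μ : VermaSl.weightLattice m) :
    FiniteDimensional ℂ (VermaSl.vermaWeightSpace l μ) ∧
    Module.finrank ℂ (VermaSl.vermaWeightSpace l μ) = VermaSl.kostantPartition (μ - l) ∧
    ∀ i j : Fin m,
      Module.finrank ℂ (VermaSl.vermaWeightSpace l μ) ^ 2 ≥
        Module.finrank ℂ (VermaSl.vermaWeightSpace l (VermaSl.shift μ i j)) *
          Module.finrank ℂ (VermaSl.vermaWeightSpace l (VermaSl.shift μ j i)) := by
  have h := fun ν : VermaSl.weightLattice m =>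
    VermaSl.finrank_vermaWeightSpace l ν (VermaSl.finite_rootSum_eq _)
  refine ⟨(h μ).1, (h μ).2, fun i j => ?_⟩
  have e : ∀ i j, VermaSl.shift μ i j - l = μ - l + VermaSl.e i - VermaSl.e j := by
    intro i j
    rw [VermaSl.shift]
    abel
  rw [(h μ).2, (h _).2, (h _).2, e, e]
  exact VermaSl.kostantPartition_log_concave (μ - l) i j
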